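/- Let $(M^m,g)$ and $(N^n,h)$ be smooth Riemannian manifolds with $N \neq \emptyset$, let $\Delta$ denote the Laplace-Beltrami operator, and call a smooth function $f$ on an open set harmonic if $\Delta f=0$ and biharmonic if $\Delta(\Delta f)=0$ there. A smooth map $\phi$ between Riemannian manifolds is a *harmonic morphism* (respectively a *generalized harmonic morphism*) if for every open subset $U$ of the target with $\phi^{-1}(U)\neq\emptyset$ and every harmonic function $f:U\to\mathbb{R}$ the function $f\circ\phi$ is harmonic (respectively biharmonic) on $\phi^{-1}(U)$. It is *horizontally weakly conformal* if there is a function $\lambda\ge 0$ on its domain such that at each point $x$ either $d\phi_x=0$ and $\lambda(x)=0$, or $\lambda(x)>0$, $d\phi_x$ is surjective, and $\langle d\phi_x X,d\phi_x Y\rangle=\lambda(x)^2\langle X,Y\rangle$ for all $X,Y$ orthogonal to $\ker d\phi_x$. A smooth map $\phi=(\phi^1,\dots,\phi^k)$ into the Euclidean space $\mathbb{R}^k$ is *harmonic* if $\Delta\phi^\alpha=0$ for all $\alpha$, *biharmonic* if $\Delta(\Delta\phi^\alpha)=0$ for all $\alpha$, and *proper biharmonic* if it is biharmonic and not harmonic.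 Let $\psi:(M^m,g)\to\mathbb{R}^k$ be a generalized harmonic morphism and $\varphi:(N^n,h)\to\mathbb{R}^k$ a harmonic morphism. Then their direct sum $\psi\oplus\varphi:(M\times N,\,g\times h)\to\mathbb{R}^k$, $(\psi\oplus\varphi)(x,y)=\psi(x)+\varphi(y)$, is a generalized harmonic morphism. In particular, $\psi\oplus\varphi$ is a horizontally weakly conformal biharmonic map, and it is proper biharmonic whenever $\psi$ is not a harmonic map. -/

import Mathlib

open Manifold
open scoped ContDiff Topology

set_option maxSynthPendingDepth 3

noncomputable section

section Riemannian

variable {E : Type*} [NormedAddCommGroup E] [NormedSpace ℝ E]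
  {H : Type*} [TopologicalSpace H] {I : ModelWithCorners ℝ E H}
  {M : Type*} [TopologicalSpace M] [ChartedSpace H M] [IsManifold I ∞ M]
  {F : Type*} [NormedAddCommGroup F] [NormedSpace ℝ F]
  {K : Type*} [TopologicalSpace K] {J : ModelWithCorners ℝ F K}
  {N : Type*} [TopologicalSpace N] [ChartedSpace K N] [IsManifold J ∞ N]

/-! ### Riemannian metrics and the product metric -/

/-- A smooth Riemannian metric on the manifold `M`. -/
abbrev SmoothMetric {E : Type*} [NormedAddCommGroup E] [NormedSpace ℝ E]
    {H : Type*} [TopologicalSpace H] (I : ModelWithCorners ℝ E H)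
    (M : Type*) [TopologicalSpace M] [ChartedSpace H M] [IsManifold I ∞ M] :=
  Bundle.ContMDiffRiemannianMetric I ∞ E (fun x : M => TangentSpace I x)

/-- The orthogonal sum of two bilinear forms:
`((u, u'), (v, v')) ↦ B u v + C u' v'`. -/
def prodInner (B : E →L[ℝ] E →L[ℝ] ℝ) (C : F →L[ℝ] F →L[ℝ] ℝ) :
    E × F →L[ℝ] E × F →L[ℝ] ℝ :=
  B.bilinearComp (ContinuousLinearMap.fst ℝ E F) (ContinuousLinearMap.fst ℝ E F) +
  C.bilinearComp (ContinuousLinearMap.snd ℝ E F) (ContinuousLinearMap.snd ℝ E F)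

theorem prodInner_apply (B : E →L[ℝ] E →L[ℝ] ℝ) (C : F →L[ℝ] F →L[ℝ] ℝ) (u v : E × F) :
   prodInner B C u v = B u.1 v.1 + C u.2 v.2 := by simp [prodInner]

theorem prodInner_pos (B : E →L[ℝ] E →L[ℝ] ℝ) (C : F →L[ℝ] F →L[ℝ] ℝ)
    (hB : ∀ v, v ≠ 0 → 0 < B v v) (hC : ∀ v, v ≠ 0 → 0 < C v v) (v : E × F) (hv : v ≠ 0) :
    0 < prodInner B C v v := by
  rw [prodInner_apply]
  obtain ⟨v₁, v₂⟩ := v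
  by_cases h1 : v₁ = 0
  · have h2 : v₂ ≠ 0 := fun h => hv (by rw [h1, h]; rfl)
    simpa [h1] using hC v₂ h2
  · by_cases h2 : v₂ = 0
    · simpa [h2] using hB v₁ h1
    · exact add_pos (hB v₁ h1) (hC v₂ h2)

theorem prodInner_isVonNBounded (B : E →L[ℝ] E →L[ℝ] ℝ)  (C : F →L[ℝ] F →L[ℝ] ℝ) (hB : ∀ v, v ≠ 0 → 0 < B v v) (hC : ∀ v, v ≠ 0 → 0 < C v v)
   (hb : Bornology.IsVonNBounded ℝ {v | B v v < 1}) (hc : Bornology.IsVonNBounded ℝ {v | C v v < 1}) :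
   Bornology.IsVonNBounded ℝ {v | prodInner B C v v < 1} := by
  have hs : Bornology.IsVonNBounded ℝ ({v | B v v < 1} ×ˢ {v | C v v < 1}) := by
    rw [NormedSpace.isVonNBounded_iff] at hb hc ⊢
    exact hb.prod hc
  refine Bornology.IsVonNBounded.subset ?_ hs
  rintro ⟨u, v⟩ h
  have h1 : 0 ≤ B u u := by
    by_cases hu : u = 0
    · simp [hu]
    · exact (hB u hu).le
  have h2 : 0 ≤ C v v := by
    by_cases hu : v = 0
    · simp [hu]
    · exact (hC v hu).le
  simp only [Set.mem_ofPred_eq, prodInner_apply] at h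
  constructor <;> simp only [Set.mem_ofPred_eq] <;> linarith

theorem symmL_prod (p q : M × N) (hq : q ∈ (chartAt (ModelProd H K) p).source) (v : E × F) :
    ((trivializationAt (E × F) (TangentSpace (I.prod J)) p).symmL ℝ q v : E × F) =
     (((trivializationAt E (TangentSpace I) p.1).symmL ℝ q.1 v.1 : E),
      ((trivializationAt F (TangentSpace J) p.2).symmL ℝ q.2 v.2 : F)) := by
  have hq' : q.1 ∈ (chartAt H p.1).source ∧ q.2 ∈ (chartAt K p.2).source := by
    simpa using hq
  rw [TangentBundle.symmL_trivializationAt hq, TangentBundle.symmL_trivializationAt hq'.1,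
    TangentBundle.symmL_trivializationAt hq'.2]
  have e := mfderivWithin_prodMap (I := 𝓘(ℝ, E)) (I' := 𝓘(ℝ, F))
    (mdifferentiableWithinAt_extChartAt_symm (x := p.1) (I := I) (z := extChartAt I p.1 q.1)
      ((extChartAt I p.1).map_source (by simpa using hq'.1)))
    (mdifferentiableWithinAt_extChartAt_symm (x := p.2) (I := J)  (z := extChartAt J p.2 q.2)
      ((extChartAt J p.2).map_source (by simpa using hq'.2)))
    (p := (extChartAt I p.1 q.1, extChartAt J p.2 q.2))
    (I.uniqueMDiffOn _ (Set.mem_range_self _)) (J.uniqueMDiffOn _ (Set.mem_range_self _))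
  have r : Set.range (I.prod J) = Set.range I ×ˢ Set.range J := ModelWithCorners.range_prod
  rw [extChartAt_prod, r, modelWithCornersSelf_prod, ← chartedSpaceSelf_prod]
  exact DFunLike.congr_fun e v

theorem inCoordinates_metric (B : ∀ x : M, TangentSpace I x →L[ℝ] TangentSpace I x →L[ℝ] ℝ)
    (x₀ x : M) (hx : x ∈ (chartAt H x₀).source) (u v : E) :
    (ContinuousLinearMap.inCoordinates E (TangentSpace I) (E →L[ℝ] ℝ)
      (fun x : M => TangentSpace I x →L[ℝ] ℝ) x₀ x x₀ x (B x)) u v =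
    B x ((trivializationAt E (TangentSpace I) x₀).symmL ℝ x u)
      ((trivializationAt E (TangentSpace I) x₀).symmL ℝ x v) := by
  have := inCoordinates_apply_eq₂ (𝕜 := ℝ) (F₁ := E) (F₂ := E) (F₃ := ℝ) (E₁ := fun x : M => TangentSpace I x)
    (E₂ := fun x : M => TangentSpace I x) (E₃ := fun _ : M => ℝ) (x₀ := x₀) (x := x) (ϕ := B x) (v := u) (w := v)
    (by simpa using hx) (by simpa using hx) (Set.mem_univ _)
  rw [this]
  simp only [Bundle.Trivial.fiberBundle_trivializationAt', Bundle.Trivial.linearMapAt_trivialization,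
    LinearMap.id_coe, id_eq]
  have hb : x ∈ (trivializationAt E (TangentSpace I) x₀).baseSet := by simpa using hx
  exact (congrArg₂ (fun a b => B x a b) (Bundle.Trivialization.symmL_apply (R := ℝ) _ hb u)
    (Bundle.Trivialization.symmL_apply (R := ℝ) _ hb v)).symm

theorem contDiff_bilinearComp (l : F →L[ℝ] E) :
      ContDiff ℝ ∞ (fun B : E →L[ℝ] E →L[ℝ] ℝ => B.bilinearComp l l) := by
  have h1 : ContDiff ℝ ∞ (fun B : E →L[ℝ] E →L[ℝ] ℝ => (B.comp l).flip) :=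
    (ContinuousLinearMap.flipₗᵢ ℝ F E ℝ).contDiff.comp (contDiff_id.clm_comp contDiff_const)
  exact (ContinuousLinearMap.flipₗᵢ ℝ F F ℝ).contDiff.comp (h1.clm_comp contDiff_const)

theorem contMDiffAt_prodInner {EX : Type*} [NormedAddCommGroup EX] [NormedSpace ℝ EX] {HX : Type*} [TopologicalSpace HX]
    {I' : ModelWithCorners ℝ EX HX} {X : Type*} [TopologicalSpace X] [ChartedSpace HX X] {a : X → E →L[ℝ] E →L[ℝ] ℝ} {b : X → F →L[ℝ] F →L[ℝ] ℝ} {p : X}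
    (ha : ContMDiffAt I' 𝓘(ℝ, E →L[ℝ] E →L[ℝ] ℝ) ∞ a p)
    (hb : ContMDiffAt I' 𝓘(ℝ, F →L[ℝ] F →L[ℝ] ℝ) ∞ b p) :
    ContMDiffAt I' 𝓘(ℝ, E × F →L[ℝ] E × F →L[ℝ] ℝ) ∞ (fun x => prodInner (a x) (b x)) p := by
  have h1 : ContMDiffAt I' 𝓘(ℝ, E × F →L[ℝ] E × F →L[ℝ] ℝ) ∞ (fun x => (a x).bilinearComp
      (ContinuousLinearMap.fst ℝ E F) (ContinuousLinearMap.fst ℝ E F)) p :=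
    (contDiff_bilinearComp (ContinuousLinearMap.fst ℝ E F)).contDiffAt.comp_contMDiffAt ha
  have h2 : ContMDiffAt I' 𝓘(ℝ, E × F →L[ℝ] E × F →L[ℝ] ℝ) ∞ (fun x => (b x).bilinearComp
      (ContinuousLinearMap.snd ℝ E F) (ContinuousLinearMap.snd ℝ E F)) p :=
    (contDiff_bilinearComp (ContinuousLinearMap.snd ℝ E F)).contDiffAt.comp_contMDiffAt hb
  exact h1.add h2

theorem inCoordinates_prodInner (g : SmoothMetric I M) (h : SmoothMetric J N) (p q : M × N)
    (hq : q ∈ (chartAt (ModelProd H K) p).source) :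
    ContinuousLinearMap.inCoordinates (E × F) (TangentSpace (I.prod J)) (E × F →L[ℝ] ℝ)
        (fun x : M × N => TangentSpace (I.prod J) x →L[ℝ] ℝ) p q p q
        (prodInner (E := E) (F := F) (g.inner q.1) (h.inner q.2)) =
      prodInner
        (ContinuousLinearMap.inCoordinates E (TangentSpace I) (E →L[ℝ] ℝ)
          (fun x : M => TangentSpace I x →L[ℝ] ℝ) p.1 q.1 p.1 q.1 (g.inner q.1))
        (ContinuousLinearMap.inCoordinates F (TangentSpace J) (F →L[ℝ] ℝ)
          (fun x : N => TangentSpace J x →L[ℝ] ℝ) p.2 q.2 p.2 q.2 (h.inner q.2)) := by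
  have hq' : q.1 ∈ (chartAt H p.1).source ∧ q.2 ∈ (chartAt K p.2).source := by
    simpa using hq
  refine ContinuousLinearMap.ext fun u => ContinuousLinearMap.ext fun v => ?_
  rw [prodInner_apply, inCoordinates_metric g.inner p.1 q.1 hq'.1,
    inCoordinates_metric h.inner p.2 q.2 hq'.2]
  refine (inCoordinates_metric (I := I.prod J)
    (fun q : M × N => prodInner (E := E) (F := F) (g.inner q.1) (h.inner q.2)) p q hq u v).trans ?_
  refine (prodInner_apply (E := E) (F := F) _ _ _ _).trans ?_
  have e1 := symmL_prod (I := I) (J := J) p q hq u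
  have e2 := symmL_prod (I := I) (J := J) p q hq v
  exact congrArg₂ (fun a b : E × F => g.inner q.1 a.1 b.1 + h.inner q.2 a.2 b.2) e1 e2

/-- The product metric `g × h` on `M × N`: under `T_(x,y) (M × N) = T_x M × T_y N` it is
`((u, u'), (v, v')) ↦ g_x (u, v) + h_y (u', v')`. -/
def SmoothMetric.prod (g : SmoothMetric I M) (h : SmoothMetric J N) :
    SmoothMetric (I.prod J) (M × N) where
  inner p := prodInner (E := E) (F := F) (g.inner p.1) (h.inner p.2)
  symm p v w := by
    have h1 := g.symm p.1 v.1 w.1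
    have h2 := h.symm p.2 v.2 w.2
    exact (prodInner_apply (E := E) (F := F) _ _ _ _).trans ((congrArg₂ (· + ·) h1 h2).trans (prodInner_apply (E := E) (F := F) _ _ _ _).symm)
  pos p v hv := by
    exact prodInner_pos (E := E) (F := F) _ _ (g.pos p.1) (h.pos p.2) v hv
  isVonNBounded p := prodInner_isVonNBounded (E := E) (F := F) _ _ (g.pos p.1) (h.pos p.2) (g.isVonNBounded p.1) (h.isVonNBounded p.2)
  contMDiff := by
    intro p
    have hg := g.contMDiff p.1
    have hh := h.contMDiff p.2
    rw [contMDiffAt_hom_bundle] at hg hh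
    refine (contMDiffAt_hom_bundle _).2 ⟨contMDiffAt_id, ?_⟩
    have h1 := hg.2.comp p (contMDiffAt_fst (I := I) (J := J))
    have h2 := hh.2.comp p (contMDiffAt_snd (I := I) (J := J))
    refine ContMDiffAt.congr_of_eventuallyEq (f := fun q : M × N => prodInner
      (ContinuousLinearMap.inCoordinates E (TangentSpace I) (E →L[ℝ] ℝ)
        (fun x : M => TangentSpace I x →L[ℝ] ℝ) p.1 q.1 p.1 q.1 (g.inner q.1))
      (ContinuousLinearMap.inCoordinates F (TangentSpace J) (F →L[ℝ] ℝ)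
        (fun x : N => TangentSpace J x →L[ℝ] ℝ) p.2 q.2 p.2 q.2 (h.inner q.2)))
      (contMDiffAt_prodInner h1 h2) ?_
    filter_upwards [(chartAt (ModelProd H K) p).open_source.mem_nhds (mem_chart_source _ p)] with q hq
    have hq' : q.1 ∈ (chartAt H p.1).source ∧ q.2 ∈ (chartAt K p.2).source := by
      simpa using hq
    exact inCoordinates_prodInner g h p q hq

/-! ### The Laplace-Beltrami operator -/

/-- The metric read in the preferred chart around `x`: its value at the point `y` of the model
space is the pull back of the inner product by the derivative of the inverse of the chart,
i.e. `g_ij (y)` without a choice of basis. -/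
def metricInChart (g : SmoothMetric I M) (x : M) (y : E) : E →L[ℝ] E →L[ℝ] ℝ :=
  ContinuousLinearMap.bilinearComp (E := E) (F := E) (g.inner ((extChartAt I x).symm y))
    (mfderiv 𝓘(ℝ, E) I (extChartAt I x).symm y) (mfderiv 𝓘(ℝ, E) I (extChartAt I x).symm y)

/-- Christoffel symbols of the first kind of a metric `B` on (an open subset of) a vector space:
`(u, v, w) ↦ ((D_u B) (v, w) + (D_v B) (u, w) - (D_w B) (u, v)) / 2`,
see `koszulForm_apply`. -/
def koszulForm (B : E → E →L[ℝ] E →L[ℝ] ℝ) (y : E) : E →L[ℝ] E →L[ℝ] E →L[ℝ] ℝ :=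
  let D : E →L[ℝ] E →L[ℝ] E →L[ℝ] ℝ := fderiv ℝ B y
  let S : (E →L[ℝ] E →L[ℝ] ℝ) →L[ℝ] (E →L[ℝ] E →L[ℝ] ℝ) :=
    (ContinuousLinearMap.flipₗᵢ ℝ E E ℝ).toContinuousLinearEquiv.toContinuousLinearMap
  (1 / 2 : ℝ) • (D + D.flip - S.comp D.flip)

theorem koszulForm_apply (B : E → E →L[ℝ] E →L[ℝ] ℝ) (y u v w : E) :
    koszulForm B y u v w =
      (fderiv ℝ B y u v w + fderiv ℝ B y v u w - fderiv ℝ B y w u v) / 2 := by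
  simp [koszulForm]; ring

/-- Christoffel symbols of the second kind (the Levi-Civita connection in the chart):
`Γ (u, v)` is the vector with `B (Γ (u, v), w) = koszulForm B y u v w` for all `w`. -/
def christoffel (B : E → E →L[ℝ] E →L[ℝ] ℝ) (y : E) : E →L[ℝ] E →L[ℝ] E :=
  (ContinuousLinearMap.compL ℝ E (E →L[ℝ] ℝ) E (B y).inverse) ∘L koszulForm B y

/-- The covariant Hessian `∇ dF` in a chart: `(u, v) ↦ D² F (u, v) - DF (Γ (u, v))`. -/
def hessianInChart (B : E → E →L[ℝ] E →L[ℝ] ℝ) (F : E → ℝ) (y : E) : E →L[ℝ] E →L[ℝ] ℝ :=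
  fderiv ℝ (fderiv ℝ F) y - (ContinuousLinearMap.compL ℝ E E ℝ (fderiv ℝ F y)) ∘L christoffel B y

/-- The Laplace-Beltrami operator: the trace of the covariant Hessian with respect to the metric,
`Δ f = g^{ij} (∂_i ∂_j f - Γ_{ij}^k ∂_k f)`, computed at `x` in the preferred chart around `x`. -/
def laplaceBeltrami (g : SmoothMetric I M) (f : M → ℝ) (x : M) : ℝ :=
  LinearMap.trace ℝ E ((metricInChart g x (extChartAt I x x)).inverse ∘L
    hessianInChart (metricInChart g x) (f ∘ (extChartAt I x).symm) (extChartAt I x x)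
      : E →L[ℝ] E).toLinearMap

/-! ### Harmonic and biharmonic functions, morphisms and maps -/

/-- `f` is a harmonic function on the open set `U`: smooth there with `Δ f = 0`. -/
def IsHarmonicOn (g : SmoothMetric I M) (f : M → ℝ) (U : Set M) : Prop :=
  ContMDiffOn I 𝓘(ℝ, ℝ) ∞ f U ∧ ∀ x ∈ U, laplaceBeltrami g f x = 0

/-- `f` is a biharmonic function on the open set `U`: smooth there with `Δ (Δ f) = 0`. -/
def IsBiharmonicOn (g : SmoothMetric I M) (f : M → ℝ) (U : Set M) : Prop :=
  ContMDiffOn I 𝓘(ℝ, ℝ) ∞ f U ∧ ∀ x ∈ U, laplaceBeltrami g (laplaceBeltrami g f) x = 0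

/-- A harmonic morphism: a smooth map that pulls back local harmonic functions to harmonic
functions. -/
def IsHarmonicMorphism (g : SmoothMetric I M) (h : SmoothMetric J N) (φ : M → N) : Prop :=
  ContMDiff I J ∞ φ ∧
    ∀ (U : Set N) (f : N → ℝ), IsOpen U → (φ ⁻¹' U).Nonempty → IsHarmonicOn h f U →
      IsHarmonicOn g (f ∘ φ) (φ ⁻¹' U)

/-- A generalized harmonic morphism: a smooth map that pulls back local harmonic functions to
biharmonic functions. -/
def IsGeneralizedHarmonicMorphism (g : SmoothMetric I M) (h : SmoothMetric J N) (φ : M → N) :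
    Prop :=
  ContMDiff I J ∞ φ ∧
    ∀ (U : Set N) (f : N → ℝ), IsOpen U → (φ ⁻¹' U).Nonempty → IsHarmonicOn h f U →
      IsBiharmonicOn g (f ∘ φ) (φ ⁻¹' U)

/-- The tangent vector `X` at `x` is horizontal for `φ`: orthogonal to the kernel of `dφ_x`. -/
def IsHorizontal (g : SmoothMetric I M) (J : ModelWithCorners ℝ F K) (φ : M → N) (x : M)
    (X : TangentSpace I x) : Prop :=
  ∀ V : TangentSpace I x, mfderiv I J φ x V = 0 → g.inner x X V = 0

/-- Horizontally weakly conformal maps: there is a function `dil ≥ 0` (the dilation) such that at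
each point `x` either `dφ_x = 0` and `dil x = 0`, or `dφ_x` maps the horizontal space onto
`T_{φ x} N` and multiplies inner products of horizontal vectors by `(dil x) ^ 2 > 0`. -/
def IsHorizontallyWeaklyConformal (g : SmoothMetric I M) (h : SmoothMetric J N) (φ : M → N) :
    Prop :=
  ContMDiff I J ∞ φ ∧ ∃ dil : M → ℝ, ∀ x : M,
    (mfderiv I J φ x = 0 ∧ dil x = 0) ∨
    (0 < dil x ∧ Function.Surjective (mfderiv I J φ x) ∧
      ∀ X Y : TangentSpace I x, IsHorizontal g J φ x X → IsHorizontal g J φ x Y →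
        h.inner (φ x) (mfderiv I J φ x X) (mfderiv I J φ x Y) = dil x ^ 2 * g.inner x X Y)

/-- The tension field of a map into the Euclidean space `ℝᵏ`; as the target is flat, it is the
Laplacian taken componentwise. -/
def tensionField (g : SmoothMetric I M) {k : ℕ} (φ : M → EuclideanSpace ℝ (Fin k)) (x : M) :
    EuclideanSpace ℝ (Fin k) :=
  WithLp.toLp 2 fun α => laplaceBeltrami g (fun y => φ y α) x

/-- Harmonic maps into `ℝᵏ`: smooth with vanishing tension field. -/
def IsHarmonicMap (g : SmoothMetric I M) {k : ℕ} (φ : M → EuclideanSpace ℝ (Fin k)) : Prop :=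
  ContMDiff I 𝓘(ℝ, EuclideanSpace ℝ (Fin k)) ∞ φ ∧ ∀ x, tensionField g φ x = 0

/-- Biharmonic maps into `ℝᵏ`: smooth with vanishing bitension field. As the target is flat, the
bitension field is (up to sign) the Laplacian of the tension field. -/
def IsBiharmonicMap (g : SmoothMetric I M) {k : ℕ} (φ : M → EuclideanSpace ℝ (Fin k)) : Prop :=
  ContMDiff I 𝓘(ℝ, EuclideanSpace ℝ (Fin k)) ∞ φ ∧ ∀ x, tensionField g (tensionField g φ) x = 0

/-- Proper biharmonic maps: biharmonic maps that are not harmonic. -/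
def IsProperBiharmonicMap (g : SmoothMetric I M) {k : ℕ} (φ : M → EuclideanSpace ℝ (Fin k)) :
    Prop :=
  IsBiharmonicMap g φ ∧ ¬ IsHarmonicMap g φ

/-- The direct sum `(x, y) ↦ ψ x + φ y` of two maps into `ℝᵏ`. -/
def directSum {M N : Type*} {k : ℕ} (ψ : M → EuclideanSpace ℝ (Fin k))
    (φ : N → EuclideanSpace ℝ (Fin k)) (p : M × N) : EuclideanSpace ℝ (Fin k) :=
  ψ p.1 + φ p.2

/-- The standard flat metric on `ℝᵏ`. -/
def euclideanMetric (k : ℕ) :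
    SmoothMetric 𝓘(ℝ, EuclideanSpace ℝ (Fin k)) (EuclideanSpace ℝ (Fin k)) where
  inner := (riemannianMetricVectorSpace (EuclideanSpace ℝ (Fin k))).inner
  symm := (riemannianMetricVectorSpace (EuclideanSpace ℝ (Fin k))).symm
  pos := (riemannianMetricVectorSpace (EuclideanSpace ℝ (Fin k))).pos
  isVonNBounded := (riemannianMetricVectorSpace (EuclideanSpace ℝ (Fin k))).isVonNBounded
  contMDiff := (riemannianMetricVectorSpace (EuclideanSpace ℝ (Fin k))).contMDiff.of_le le_top

end Riemannian

end

/-! Put `F = f ∘ directSum ψ φ` and write `Δ_M`, `Δ_N` for the Laplacians in the two variables. The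
product Laplacian is `Δ_M + Δ_N`. With `x` frozen, `F` is a translate of `f` composed with `φ`;
translates of harmonic functions are harmonic, so `Δ_N F = 0`. With `y` frozen the same argument
gives `Δ_M Δ_M F = 0`. Hence `Δ F = Δ_M F`, and `Δ Δ F = Δ_M Δ_M F + Δ_N Δ_M F = Δ_M Δ_N F = 0`,
once the two partial Laplacians are known to commute.

The analytic input is threefold. `laplaceBeltrami_eq_chartLaplacian` (chart independence) allows a
Laplacian to be differentiated again; `laplaceBeltrami_prod` splits the product Laplacian;
`laplaceBeltrami_slice_comm` is the commutation, reduced to Schwarz's theorem by freezing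
coefficients.

Horizontal weak conformality holds for every generalized harmonic morphism into `ℝᵏ`. The test
functions are the real and imaginary parts of `((y i - c) + √-1 (y j - d)) ^ 4`, which are harmonic.
Centred at `ψ x`, their pullbacks vanish to fourth order at `x`, so their bilaplacians there involve
only inner products of the gradients of `ψ i` and `ψ j`; the vanishing of both forces these
gradients to be orthogonal and of equal length. Coordinate functions as tests give biharmonicity.
Finally the tension field of the sum is the sum of the tension fields, and that of `φ` is zero, so
the sum is harmonic only if `ψ` is. -/

set_option linter.unusedSectionVars false

noncomputable section

/-! ### The Laplacian in a chart: invariance under coordinate changes, smoothness, product rule. -/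

section ChartLaplacian

variable {E : Type*} [NormedAddCommGroup E] [NormedSpace ℝ E]
  {F : Type*} [NormedAddCommGroup F] [NormedSpace ℝ F]

/-- The Laplacian of the metric `B` on (an open subset of) a vector space. -/
def chartLaplacian (B : E → E →L[ℝ] E →L[ℝ] ℝ) (f : E → ℝ) (y : E) : ℝ :=
  LinearMap.trace ℝ E ((B y).inverse ∘L hessianInChart B f y : E →L[ℝ] E).toLinearMap

theorem christoffel_apply (B : E → E →L[ℝ] E →L[ℝ] ℝ) (y u v : E) :
    christoffel B y u v = (B y).inverse (koszulForm B y u v) := rfl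

theorem hessianInChart_apply (B : E → E →L[ℝ] E →L[ℝ] ℝ) (f : E → ℝ) (y u v : E) :
    hessianInChart B f y u v = fderiv ℝ (fderiv ℝ f) y u v - fderiv ℝ f y (christoffel B y u v) :=
  rfl

theorem hessianInChart_congr_metric {B B' : E → E →L[ℝ] E →L[ℝ] ℝ} {f f' : E → ℝ} {y : E}
    (hB : B =ᶠ[𝓝 y] B') (hf : f =ᶠ[𝓝 y] f') : hessianInChart B f y = hessianInChart B' f' y := by
  have h1 : koszulForm B y = koszulForm B' y := by simp only [koszulForm, hB.fderiv_eq]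
  have h2 : christoffel B y = christoffel B' y := by simp only [christoffel, h1, hB.eq_of_nhds]
  simp only [hessianInChart, h2, hf.fderiv_eq, hf.fderiv.fderiv_eq]

theorem chartLaplacian_congr {B B' : E → E →L[ℝ] E →L[ℝ] ℝ} {f f' : E → ℝ} {y : E}
    (hB : B =ᶠ[𝓝 y] B') (hf : f =ᶠ[𝓝 y] f') : chartLaplacian B f y = chartLaplacian B' f' y := by
  simp only [chartLaplacian, hessianInChart_congr_metric hB hf, hB.eq_of_nhds]

theorem differentiableAt_bilinearComp {G : Type*} [NormedAddCommGroup G] [NormedSpace ℝ G]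
    {B : G → F →L[ℝ] F →L[ℝ] ℝ} {a : G → E →L[ℝ] F} {y : G}
    (hB : DifferentiableAt ℝ B y) (ha : DifferentiableAt ℝ a y) :
    DifferentiableAt ℝ (fun z => (B z).bilinearComp (a z) (a z)) y := by
  have h1 : DifferentiableAt ℝ (fun z => ((B z).comp (a z)).flip) y :=
    (ContinuousLinearMap.flipₗᵢ ℝ E F ℝ).differentiable.differentiableAt.comp y (hB.clm_comp ha)
  exact (ContinuousLinearMap.flipₗᵢ ℝ E E ℝ).differentiable.differentiableAt.comp y
    (h1.clm_comp ha)

/-- Product rule for `B (T z) (DT v) (DT w)`. The two terms with `D²T` produce the inhomogeneous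
part of the transformation law of the Christoffel symbols. -/
theorem fderiv_pullback_metric {B B' : E → E →L[ℝ] E →L[ℝ] ℝ} {T : E → E} {y : E}
    (hT : ContDiffAt ℝ 2 T y) (hB : DifferentiableAt ℝ B (T y))
    (hB' : B' =ᶠ[𝓝 y] fun z => (B (T z)).bilinearComp (fderiv ℝ T z) (fderiv ℝ T z)) (u v w : E) :
    fderiv ℝ B' y u v w =
      fderiv ℝ B (T y) (fderiv ℝ T y u) (fderiv ℝ T y v) (fderiv ℝ T y w) +
      B (T y) (fderiv ℝ (fderiv ℝ T) y u v) (fderiv ℝ T y w) +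
      B (T y) (fderiv ℝ T y v) (fderiv ℝ (fderiv ℝ T) y u w) := by
  have dT : DifferentiableAt ℝ T y := hT.differentiableAt (by norm_num)
  have ddT : DifferentiableAt ℝ (fderiv ℝ T) y :=
    (hT.fderiv_right (m := 1) (by norm_num)).differentiableAt (by norm_num)
  have dBT : HasFDerivAt (fun z => B (T z)) ((fderiv ℝ B (T y)).comp (fderiv ℝ T y)) y :=
    hB.hasFDerivAt.comp y dT.hasFDerivAt
  rw [hB'.fderiv_eq]
  have hd : DifferentiableAt ℝ
      (fun z => (B (T z)).bilinearComp (fderiv ℝ T z) (fderiv ℝ T z)) y :=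
    differentiableAt_bilinearComp dBT.differentiableAt ddT
  have h1 : HasFDerivAt (fun z => (B (T z)).bilinearComp (fderiv ℝ T z) (fderiv ℝ T z) v w) _ y :=
    (hd.hasFDerivAt.clm_apply (hasFDerivAt_const v y)).clm_apply (hasFDerivAt_const w y)
  have h2 : HasFDerivAt (fun z => B (T z) (fderiv ℝ T z v) (fderiv ℝ T z w)) _ y :=
    (dBT.clm_apply (ddT.hasFDerivAt.clm_apply (hasFDerivAt_const v y))).clm_apply
      (ddT.hasFDerivAt.clm_apply (hasFDerivAt_const w y))
  have h3 := DFunLike.congr_fun (h1.unique h2) u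
  simp at h3
  rw [h3]
  ring

/-- Of the six terms containing `D²T`, symmetry of `D²T` and of `B` cancels four in pairs and makes
the other two equal, which absorbs the factor `1 / 2`. -/
theorem koszulForm_pullback {B B' : E → E →L[ℝ] E →L[ℝ] ℝ} {T : E → E} {y : E}
    (hT : ContDiffAt ℝ 2 T y) (hB : DifferentiableAt ℝ B (T y))
    (hs : ∀ u v, B (T y) u v = B (T y) v u)
    (hB' : B' =ᶠ[𝓝 y] fun z => (B (T z)).bilinearComp (fderiv ℝ T z) (fderiv ℝ T z)) (u v w : E) :
    koszulForm B' y u v w =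
      koszulForm B (T y) (fderiv ℝ T y u) (fderiv ℝ T y v) (fderiv ℝ T y w) +
      B (T y) (fderiv ℝ (fderiv ℝ T) y u v) (fderiv ℝ T y w) := by
  have sT : IsSymmSndFDerivAt ℝ T y := hT.isSymmSndFDerivAt (by simp)
  simp only [koszulForm_apply, fderiv_pullback_metric hT hB hB']
  rw [sT.eq v u, sT.eq w u, sT.eq w v, hs (fderiv ℝ T y u), hs (fderiv ℝ T y v)]
  ring

/-- Both sides are paired through `B (T y)` with vectors `DT w`; nondegeneracy of `B (T y)` and
surjectivity of `DT` reduce the claim to the Koszul forms. -/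
theorem christoffel_pullback {B B' : E → E →L[ℝ] E →L[ℝ] ℝ} {T : E → E} {y : E}
    (hT : ContDiffAt ℝ 2 T y) (hT' : (fderiv ℝ T y).IsInvertible) (hB : DifferentiableAt ℝ B (T y))
    (hs : ∀ u v, B (T y) u v = B (T y) v u) (hi : (B (T y)).IsInvertible)
    (hi' : (B' y).IsInvertible)
    (hB' : B' =ᶠ[𝓝 y] fun z => (B (T z)).bilinearComp (fderiv ℝ T z) (fderiv ℝ T z)) (u v : E) :
    fderiv ℝ T y (christoffel B' y u v) =
      christoffel B (T y) (fderiv ℝ T y u) (fderiv ℝ T y v) + fderiv ℝ (fderiv ℝ T) y u v := by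
  apply hi.injective
  ext w
  obtain ⟨w, rfl⟩ := hT'.surjective w
  have h1 : B' y (christoffel B' y u v) w = koszulForm B' y u v w := by
    rw [christoffel_apply, hi'.self_apply_inverse]
  have h2 : B (T y) (fderiv ℝ T y (christoffel B' y u v)) (fderiv ℝ T y w) =
    B' y (christoffel B' y u v) w := by rw [hB'.eq_of_nhds]; rfl
  rw [h2, h1, koszulForm_pullback hT hB hs hB', map_add, christoffel_apply, hi.self_apply_inverse]
  rfl

/-- The term `Df (D²T (u, v))` from the second-order chain rule cancels the inhomogeneous
Christoffel term, so the covariant Hessian is a tensor. -/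
theorem hessianInChart_pullback {B B' : E → E →L[ℝ] E →L[ℝ] ℝ} {T : E → E} {y : E} {f f' : E → ℝ}
    (hT : ContDiffAt ℝ 2 T y) (hT' : (fderiv ℝ T y).IsInvertible) (hB : DifferentiableAt ℝ B (T y))
    (hs : ∀ u v, B (T y) u v = B (T y) v u) (hi : (B (T y)).IsInvertible)
    (hi' : (B' y).IsInvertible)
    (hB' : B' =ᶠ[𝓝 y] fun z => (B (T z)).bilinearComp (fderiv ℝ T z) (fderiv ℝ T z))
    (hf : ContDiffAt ℝ 2 f (T y)) (hf' : f' =ᶠ[𝓝 y] f ∘ T) (u v : E) :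
    hessianInChart B' f' y u v = hessianInChart B f (T y) (fderiv ℝ T y u) (fderiv ℝ T y v) := by
  have dT : DifferentiableAt ℝ T y := hT.differentiableAt (by norm_num)
  have ddT : DifferentiableAt ℝ (fderiv ℝ T) y :=
    (hT.fderiv_right (m := 1) (by norm_num)).differentiableAt (by norm_num)
  have df : DifferentiableAt ℝ f (T y) := hf.differentiableAt (by norm_num)
  have ddf : DifferentiableAt ℝ (fderiv ℝ f) (T y) :=
    (hf.fderiv_right (m := 1) (by norm_num)).differentiableAt (by norm_num)
  have evT : ∀ᶠ z in 𝓝 y, DifferentiableAt ℝ T z :=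
    (hT.eventually (by simp)).mono fun z hz => hz.differentiableAt (by norm_num)
  have evf : ∀ᶠ z in 𝓝 (T y), DifferentiableAt ℝ f z :=
    (hf.eventually (by simp)).mono fun z hz => hz.differentiableAt (by norm_num)
  replace evf := dT.continuousAt.eventually evf
  have e1 : fderiv ℝ f' =ᶠ[𝓝 y] fun z => (fderiv ℝ f (T z)).comp (fderiv ℝ T z) := by
    filter_upwards [hf'.fderiv (𝕜 := ℝ), evT, evf] with z h1 h2 h3
    rw [h1, fderiv_comp z h3 h2]
  have e2 := e1.fderiv_eq.trans
    ((ddf.hasFDerivAt.comp y dT.hasFDerivAt).clm_comp ddT.hasFDerivAt).fderiv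
  have e3 : fderiv ℝ (fderiv ℝ f') y u v =
      fderiv ℝ (fderiv ℝ f) (T y) (fderiv ℝ T y u) (fderiv ℝ T y v) +
      fderiv ℝ f (T y) (fderiv ℝ (fderiv ℝ T) y u v) := by
    rw [e2]
    simp [add_comm]
  rw [hessianInChart_apply, hessianInChart_apply, e3, e1.eq_of_nhds]
  simp only [ContinuousLinearMap.comp_apply,
    christoffel_pullback hT hT' hB hs hi hi' hB', map_add]
  ring

/-- Raising an index of the Hessian in the two coordinate systems gives endomorphisms conjugate by
`DT`, hence of equal trace. -/
theorem chartLaplacian_pullback {B B' : E → E →L[ℝ] E →L[ℝ] ℝ} {T : E → E} {y : E} {f f' : E → ℝ}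
    (hT : ContDiffAt ℝ 2 T y) (hT' : (fderiv ℝ T y).IsInvertible) (hB : DifferentiableAt ℝ B (T y))
    (hs : ∀ u v, B (T y) u v = B (T y) v u) (hi : (B (T y)).IsInvertible)
    (hi' : (B' y).IsInvertible)
    (hB' : B' =ᶠ[𝓝 y] fun z => (B (T z)).bilinearComp (fderiv ℝ T z) (fderiv ℝ T z))
    (hf : ContDiffAt ℝ 2 f (T y)) (hf' : f' =ᶠ[𝓝 y] f ∘ T) :
    chartLaplacian B' f' y = chartLaplacian B f (T y) := by
  have hh := hessianInChart_pullback hT hT' hB hs hi hi' hB' hf hf'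
  obtain ⟨e, he⟩ := hT'
  unfold chartLaplacian
  rw [← LinearMap.trace_conj' _ e.toLinearEquiv]
  congr 1
  ext u
  obtain ⟨u, rfl⟩ := e.surjective u
  have key : (B' y).inverse (hessianInChart B' f' y u) =
      e.symm ((B (T y)).inverse (hessianInChart B f (T y) (e u))) := by
    rw [hi'.inverse_apply_eq]
    ext w
    rw [hh, hB'.eq_of_nhds]
    simp [← he, hi.self_apply_inverse]
  simp [LinearEquiv.conj_apply, key]

/-! ### Smoothness -/

theorem contDiffAt_koszulForm {B : E → E →L[ℝ] E →L[ℝ] ℝ} {y : E} (hB : ContDiffAt ℝ ∞ B y) :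
    ContDiffAt ℝ ∞ (koszulForm B) y := by
  have hD : ContDiffAt ℝ ∞ (fderiv ℝ B) y := hB.fderiv_right (by simp)
  have hF : ContDiffAt ℝ ∞ (fun z => (fderiv ℝ B z).flip) y :=
    (ContinuousLinearMap.flipₗᵢ ℝ E E (E →L[ℝ] ℝ)).contDiff.contDiffAt.comp y hD
  exact ((hD.add hF).sub (contDiffAt_const.clm_comp hF)).const_smul (1 / 2 : ℝ)

theorem contDiffAt_chartLaplacian [FiniteDimensional ℝ E] {B : E → E →L[ℝ] E →L[ℝ] ℝ} {f : E → ℝ}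
    {y : E} (hB : ContDiffAt ℝ ∞ B y) (hi : (B y).IsInvertible) (hf : ContDiffAt ℝ ∞ f y) :
    ContDiffAt ℝ ∞ (chartLaplacian B f) y := by
  have : CompleteSpace E := FiniteDimensional.complete ℝ E
  have hI : ContDiffAt ℝ ∞ (fun z => (B z).inverse) y :=
    (hi.contDiffAt_map_inverse).comp y hB
  have hD : ContDiffAt ℝ ∞ (fderiv ℝ f) y := hf.fderiv_right (by simp)
  have hDD : ContDiffAt ℝ ∞ (fderiv ℝ (fderiv ℝ f)) y := hD.fderiv_right (by simp)
  have hC : ContDiffAt ℝ ∞ (christoffel B) y :=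
    ((ContinuousLinearMap.compL ℝ E (E →L[ℝ] ℝ) E).contDiff.contDiffAt.comp y hI).clm_comp
      (contDiffAt_koszulForm hB)
  have hH : ContDiffAt ℝ ∞ (hessianInChart B f) y :=
    hDD.sub (((ContinuousLinearMap.compL ℝ E E ℝ).contDiff.contDiffAt.comp y hD).clm_comp hC)
  let tr : (E →L[ℝ] E) →L[ℝ] ℝ :=
    LinearMap.toContinuousLinearMap ((LinearMap.trace ℝ E) ∘ₗ (ContinuousLinearMap.coeLM ℝ))
  exact tr.contDiff.contDiffAt.comp y (hI.clm_comp hH)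

/-! ### The Leibniz rule -/

theorem trace_smulRight_continuous [FiniteDimensional ℝ E] (l : E →L[ℝ] ℝ) (v : E) :
    LinearMap.trace ℝ E (l.smulRight v).toLinearMap = l v :=
  LinearMap.trace_smulRight l.toLinearMap v

theorem hessianInChart_mul (B : E → E →L[ℝ] E →L[ℝ] ℝ) {f k : E → ℝ} {y : E}
    (hf : ContDiffAt ℝ 2 f y) (hk : ContDiffAt ℝ 2 k y) :
    hessianInChart B (f * k) y =
      f y • hessianInChart B k y + k y • hessianInChart B f y +
      ((fderiv ℝ f y).smulRight (fderiv ℝ k y) + (fderiv ℝ k y).smulRight (fderiv ℝ f y)) := by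
  have df := hf.differentiableAt (by norm_num)
  have dk := hk.differentiableAt (by norm_num)
  have ddf : DifferentiableAt ℝ (fderiv ℝ f) y :=
    (hf.fderiv_right (m := 1) (by norm_num)).differentiableAt (by norm_num)
  have ddk : DifferentiableAt ℝ (fderiv ℝ k) y :=
    (hk.fderiv_right (m := 1) (by norm_num)).differentiableAt (by norm_num)
  have e1 : fderiv ℝ (f * k) =ᶠ[𝓝 y] fun z => f z • fderiv ℝ k z + k z • fderiv ℝ f z := by
    filter_upwards [hf.eventually (by simp), hk.eventually (by simp)] with z h1 h2
    exact fderiv_mul (h1.differentiableAt (by norm_num)) (h2.differentiableAt (by norm_num))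
  have e2 := e1.fderiv_eq.trans
    ((df.hasFDerivAt.smul ddk.hasFDerivAt).add (dk.hasFDerivAt.smul ddf.hasFDerivAt)).fderiv
  ext u v
  rw [hessianInChart_apply, e1.eq_of_nhds, e2]
  simp [hessianInChart_apply]
  ring

/-- The cross terms of the Hessian become rank-one endomorphisms, whose traces are evaluations. No
symmetry of `B` is assumed, so the two evaluations are kept apart. -/
theorem chartLaplacian_mul [FiniteDimensional ℝ E] (B : E → E →L[ℝ] E →L[ℝ] ℝ) {f k : E → ℝ} {y : E}
    (hf : ContDiffAt ℝ 2 f y) (hk : ContDiffAt ℝ 2 k y) :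
    chartLaplacian B (f * k) y =
      f y * chartLaplacian B k y + k y * chartLaplacian B f y +
      (fderiv ℝ f y ((B y).inverse (fderiv ℝ k y)) +
        fderiv ℝ k y ((B y).inverse (fderiv ℝ f y))) := by
  have e : ∀ a b : E →L[ℝ] ℝ, (B y).inverse ∘L a.smulRight b = a.smulRight ((B y).inverse b) := by
    intro a b; ext; simp
  simp only [chartLaplacian, hessianInChart_mul B hf hk, ContinuousLinearMap.comp_add,
    ContinuousLinearMap.comp_smul, ContinuousLinearMap.toLinearMap_add,
    ContinuousLinearMap.toLinearMap_smul, map_add, map_smul, smul_eq_mul, e,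
    trace_smulRight_continuous]

theorem chartLaplacian_add (B : E → E →L[ℝ] E →L[ℝ] ℝ) {f k : E → ℝ} {y : E}
    (hf : ContDiffAt ℝ 2 f y) (hk : ContDiffAt ℝ 2 k y) :
    chartLaplacian B (f + k) y = chartLaplacian B f y + chartLaplacian B k y := by
  have ddf : DifferentiableAt ℝ (fderiv ℝ f) y :=
    (hf.fderiv_right (m := 1) (by norm_num)).differentiableAt (by norm_num)
  have ddk : DifferentiableAt ℝ (fderiv ℝ k) y :=
    (hk.fderiv_right (m := 1) (by norm_num)).differentiableAt (by norm_num)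
  have e1 : fderiv ℝ (f + k) =ᶠ[𝓝 y] fun z => fderiv ℝ f z + fderiv ℝ k z := by
    filter_upwards [hf.eventually (by simp), hk.eventually (by simp)] with z h1 h2
    exact fderiv_add (h1.differentiableAt (by norm_num)) (h2.differentiableAt (by norm_num))
  have e2 := e1.fderiv_eq.trans (ddf.hasFDerivAt.add ddk.hasFDerivAt).fderiv
  have e : hessianInChart B (f + k) y = hessianInChart B f y + hessianInChart B k y := by
    ext u v
    rw [hessianInChart_apply, e1.eq_of_nhds, e2]
    simp [hessianInChart_apply]
    ring
  simp only [chartLaplacian, e, ContinuousLinearMap.comp_add,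
    ContinuousLinearMap.toLinearMap_add, map_add]

theorem chartLaplacian_const (B : E → E →L[ℝ] E →L[ℝ] ℝ) (c : ℝ) (y : E) :
    chartLaplacian B (fun _ => c) y = 0 := by
  have e : hessianInChart B (fun _ => c) y = 0 := by
    ext u v
    simp [hessianInChart_apply]
  simp [chartLaplacian, e]

end ChartLaplacian

theorem two_le_infty : (2 : WithTop ℕ∞) ≤ ∞ :=
  ENat.LEInfty.out

/-! ### Product metrics in a chart, and commuting operators with frozen coefficients. -/

section ProductChart

variable {E : Type*} [NormedAddCommGroup E] [NormedSpace ℝ E]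
  {F : Type*} [NormedAddCommGroup F] [NormedSpace ℝ F]

/-- Meant for slices: `s` is a separate function with a pointwise formula so that `x ↦ (x, b)` can
be supplied as it stands, with `l = inl` and `c = (0, b)`. -/
theorem fderiv_comp_affine {f : E → ℝ} (l : F →L[ℝ] E) (c : E) (s : F → E) (hs : ∀ x, s x = l x + c)
    {x : F} (hf : DifferentiableAt ℝ f (s x)) :
    fderiv ℝ (fun x => f (s x)) x = (fderiv ℝ f (s x)).comp l := by
  have h1 : HasFDerivAt s l x := by
    rw [funext hs]
    exact l.hasFDerivAt.add_const c
  exact (hf.hasFDerivAt.comp x h1).fderiv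

theorem fderiv_fderiv_comp_affine {f : E → ℝ} (l : F →L[ℝ] E) (c : E) (s : F → E)
    (hs : ∀ x, s x = l x + c) {x : F} (hf : ContDiffAt ℝ 2 f (s x)) (u v : F) :
    fderiv ℝ (fderiv ℝ (fun x => f (s x))) x u v = fderiv ℝ (fderiv ℝ f) (s x) (l u) (l v) := by
  have h1 : HasFDerivAt s l x := by
    rw [funext hs]
    exact l.hasFDerivAt.add_const c
  have ddf : DifferentiableAt ℝ (fderiv ℝ f) (s x) :=
    (hf.fderiv_right (m := 1) (by norm_num)).differentiableAt (by norm_num)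
  have evf : ∀ᶠ z in 𝓝 (s x), DifferentiableAt ℝ f z :=
    (hf.eventually (by simp)).mono fun z hz => hz.differentiableAt (by norm_num)
  have e1 : fderiv ℝ (fun x => f (s x)) =ᶠ[𝓝 x] fun x => (fderiv ℝ f (s x)).comp l := by
    filter_upwards [h1.continuousAt.eventually evf] with z hz
    exact fderiv_comp_affine l c s hs hz
  have e2 := e1.fderiv_eq.trans
    ((ddf.hasFDerivAt.comp x h1).clm_comp (hasFDerivAt_const l x)).fderiv
  rw [e2]
  simp

theorem prodInner_isInvertible {B : E →L[ℝ] E →L[ℝ] ℝ} {C : F →L[ℝ] F →L[ℝ] ℝ}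
    (hB : B.IsInvertible) (hC : C.IsInvertible) : (prodInner B C).IsInvertible := by
  refine ContinuousLinearMap.IsInvertible.of_inverse
    -- The inverse restricts a functional to the two factors and inverts each block.
    (g := (B.inverse ∘L (ContinuousLinearMap.compL ℝ E (E × F) ℝ).flip
      (ContinuousLinearMap.inl ℝ E F)).prod (C.inverse ∘L
      (ContinuousLinearMap.compL ℝ F (E × F) ℝ).flip (ContinuousLinearMap.inr ℝ E F))) ?_ ?_
  · refine ContinuousLinearMap.ext fun l => ContinuousLinearMap.ext fun v => ?_
    simp [prodInner_apply, hB.self_apply_inverse, hC.self_apply_inverse, ← map_add]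
  · refine ContinuousLinearMap.ext fun v => ?_
    have h1 : (prodInner B C v).comp (ContinuousLinearMap.inl ℝ E F) = B v.1 := by
      ext w; simp [prodInner_apply]
    have h2 : (prodInner B C v).comp (ContinuousLinearMap.inr ℝ E F) = C v.2 := by
      ext w; simp [prodInner_apply]
    simp [h1, h2, hB.inverse_apply_self, hC.inverse_apply_self]

theorem prodInner_inverse_apply {B : E →L[ℝ] E →L[ℝ] ℝ} {C : F →L[ℝ] F →L[ℝ] ℝ}
    (hB : B.IsInvertible) (hC : C.IsInvertible) (l : E × F →L[ℝ] ℝ) :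
    (prodInner B C).inverse l = (B.inverse (l.comp (ContinuousLinearMap.inl ℝ E F)),
      C.inverse (l.comp (ContinuousLinearMap.inr ℝ E F))) := by
  rw [(prodInner_isInvertible hB hC).inverse_apply_eq]
  refine ContinuousLinearMap.ext fun v => ?_
  simp [prodInner_apply, hB.self_apply_inverse, hC.self_apply_inverse, ← map_add]

theorem fderiv_prodInner {B : E → E →L[ℝ] E →L[ℝ] ℝ} {C : F → F →L[ℝ] F →L[ℝ] ℝ} {p : E × F}
    (hB : DifferentiableAt ℝ B p.1) (hC : DifferentiableAt ℝ C p.2) (u v w : E × F) :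
    fderiv ℝ (fun q : E × F => prodInner (B q.1) (C q.2)) p u v w =
      fderiv ℝ B p.1 u.1 v.1 w.1 + fderiv ℝ C p.2 u.2 v.2 w.2 := by
  have h1 : HasFDerivAt (fun q : E × F => B q.1) _ p := hB.hasFDerivAt.comp p hasFDerivAt_fst
  have h2 : HasFDerivAt (fun q : E × F => C q.2) _ p := hC.hasFDerivAt.comp p hasFDerivAt_snd
  have hd : DifferentiableAt ℝ (fun q : E × F => prodInner (B q.1) (C q.2)) p :=
    (differentiableAt_bilinearComp h1.differentiableAt (differentiableAt_const _)).add
      (differentiableAt_bilinearComp h2.differentiableAt (differentiableAt_const _))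
  have h3 : HasFDerivAt (fun q : E × F => prodInner (B q.1) (C q.2) v w) _ p :=
    (hd.hasFDerivAt.clm_apply (hasFDerivAt_const v p)).clm_apply (hasFDerivAt_const w p)
  have h4 : HasFDerivAt (fun q : E × F => B q.1 v.1 w.1 + C q.2 v.2 w.2) _ p :=
    ((h1.clm_apply (hasFDerivAt_const v.1 p)).clm_apply (hasFDerivAt_const w.1 p)).add
    ((h2.clm_apply (hasFDerivAt_const v.2 p)).clm_apply (hasFDerivAt_const w.2 p))
  simp only [prodInner_apply] at h3
  have h5 := DFunLike.congr_fun (h3.unique h4) u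
  simpa using h5

theorem koszulForm_prodInner {B : E → E →L[ℝ] E →L[ℝ] ℝ} {C : F → F →L[ℝ] F →L[ℝ] ℝ} {p : E × F}
    (hB : DifferentiableAt ℝ B p.1) (hC : DifferentiableAt ℝ C p.2) (u v w : E × F) :
    koszulForm (fun q : E × F => prodInner (B q.1) (C q.2)) p u v w =
      koszulForm B p.1 u.1 v.1 w.1 + koszulForm C p.2 u.2 v.2 w.2 := by
  simp only [koszulForm_apply, fderiv_prodInner hB hC]
  ring

theorem christoffel_prodInner {B : E → E →L[ℝ] E →L[ℝ] ℝ} {C : F → F →L[ℝ] F →L[ℝ] ℝ} {p : E × F}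
    (hB : DifferentiableAt ℝ B p.1) (hC : DifferentiableAt ℝ C p.2)
    (hi : (B p.1).IsInvertible) (hj : (C p.2).IsInvertible) (u v : E × F) :
    christoffel (fun q : E × F => prodInner (B q.1) (C q.2)) p u v =
      (christoffel B p.1 u.1 v.1, christoffel C p.2 u.2 v.2) := by
  rw [christoffel_apply, prodInner_inverse_apply hi hj, christoffel_apply, christoffel_apply]
  congr 2
  · ext w
    simp [koszulForm_prodInner hB hC]
  · ext w
    simp [koszulForm_prodInner hB hC]

/-- Split `A` by the component of its output and move the inclusion to the other side by cyclicity
of the trace. -/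
theorem trace_prod [FiniteDimensional ℝ E] [FiniteDimensional ℝ F] (A : E × F →ₗ[ℝ] E × F) :
    LinearMap.trace ℝ (E × F) A =
      LinearMap.trace ℝ E (LinearMap.fst ℝ E F ∘ₗ A ∘ₗ LinearMap.inl ℝ E F) +
      LinearMap.trace ℝ F (LinearMap.snd ℝ E F ∘ₗ A ∘ₗ LinearMap.inr ℝ E F) := by
  have e : A = LinearMap.inl ℝ E F ∘ₗ (LinearMap.fst ℝ E F ∘ₗ A) +
      LinearMap.inr ℝ E F ∘ₗ (LinearMap.snd ℝ E F ∘ₗ A) := by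
    refine LinearMap.ext fun v => ?_
    simp
  conv_lhs => rw [e]
  rw [map_add, LinearMap.trace_comp_comm', LinearMap.trace_comp_comm' (LinearMap.snd ℝ E F ∘ₗ A)]
  rfl

/-- The inverse metric is block diagonal, so only the two diagonal blocks of the Hessian enter the
trace; as the Christoffel symbols do not mix the factors, each block is the Hessian of a slice. -/
theorem chartLaplacian_prodInner [FiniteDimensional ℝ E] [FiniteDimensional ℝ F]
    {B : E → E →L[ℝ] E →L[ℝ] ℝ} {C : F → F →L[ℝ] F →L[ℝ] ℝ} {a : E} {b : F}
    (hB : DifferentiableAt ℝ B a) (hC : DifferentiableAt ℝ C b)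
    (hi : (B a).IsInvertible) (hj : (C b).IsInvertible) {f : E × F → ℝ}
    (hf : ContDiffAt ℝ 2 f (a, b)) :
    chartLaplacian (fun q : E × F => prodInner (B q.1) (C q.2)) f (a, b) =
      chartLaplacian B (fun x => f (x, b)) a + chartLaplacian C (fun y => f (a, y)) b := by
  have df : DifferentiableAt ℝ f (a, b) := hf.differentiableAt (by norm_num)
  have hs : ∀ x : E, (x, b) = ContinuousLinearMap.inl ℝ E F x + (0, b) := by simp
  have ht : ∀ y : F, (a, y) = ContinuousLinearMap.inr ℝ E F y + (a, 0) := by simp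
  have hch := christoffel_prodInner (p := (a, b)) hB hC hi hj
  rw [chartLaplacian, trace_prod]
  congr 1
  · rw [chartLaplacian]
    congr 1
    refine LinearMap.ext fun u => ?_
    simp only [LinearMap.comp_apply, ContinuousLinearMap.coe_coe, ContinuousLinearMap.comp_apply,
      LinearMap.fst_apply, prodInner_inverse_apply (B := B a) (C := C b) hi hj]
    congr 1
    ext v
    simp only [ContinuousLinearMap.comp_apply, hessianInChart_apply, hch,
      fderiv_comp_affine _ _ _ hs df, fderiv_fderiv_comp_affine _ _ _ hs hf]
    simp
  · rw [chartLaplacian]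
    congr 1
    refine LinearMap.ext fun u => ?_
    simp only [LinearMap.comp_apply, ContinuousLinearMap.coe_coe, ContinuousLinearMap.comp_apply,
      LinearMap.snd_apply, prodInner_inverse_apply (B := B a) (C := C b) hi hj]
    congr 1
    ext v
    simp only [ContinuousLinearMap.comp_apply, hessianInChart_apply, hch,
      fderiv_comp_affine _ _ _ ht df, fderiv_fderiv_comp_affine _ _ _ ht hf]
    simp

/-! ### Differential operators with constant coefficients -/

/-- The derivative of `f` in the direction `a`. -/
def dirDeriv (a : E) (f : E → ℝ) (y : E) : ℝ := fderiv ℝ f y a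

theorem contDiffOn_dirDeriv {O : Set E} (hO : IsOpen O) {f : E → ℝ} (hf : ContDiffOn ℝ ∞ f O)
    (a : E) : ContDiffOn ℝ ∞ (dirDeriv a f) O :=
  (hf.fderiv_of_isOpen hO (by simp)).clm_apply contDiffOn_const

theorem dirDeriv_congr {O : Set E} (hO : IsOpen O) {f k : E → ℝ} (h : Set.EqOn f k O) (a : E) :
    Set.EqOn (dirDeriv a f) (dirDeriv a k) O := fun y hy => by
  simp only [dirDeriv, (h.eventuallyEq_of_mem (hO.mem_nhds hy)).fderiv_eq]

theorem dirDeriv_dirDeriv {f : E → ℝ} {y : E} (hf : ContDiffAt ℝ 2 f y) (a b : E) :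
    dirDeriv a (dirDeriv b f) y = fderiv ℝ (fderiv ℝ f) y a b := by
  have ddf : DifferentiableAt ℝ (fderiv ℝ f) y :=
    (hf.fderiv_right (m := 1) (by norm_num)).differentiableAt (by norm_num)
  have h := (ddf.hasFDerivAt.clm_apply (hasFDerivAt_const b y)).fderiv
  exact (DFunLike.congr_fun h a).trans (by simp)

theorem dirDeriv_comm {O : Set E} (hO : IsOpen O) {f : E → ℝ} (hf : ContDiffOn ℝ ∞ f O) (a b : E) :
    Set.EqOn (dirDeriv a (dirDeriv b f)) (dirDeriv b (dirDeriv a f)) O := fun y hy => by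
  have h : ContDiffAt ℝ 2 f y := (hf.contDiffAt (hO.mem_nhds hy)).of_le two_le_infty
  rw [dirDeriv_dirDeriv h, dirDeriv_dirDeriv h]
  exact (h.isSymmSndFDerivAt (by simp)).eq a b

/-- The operator `f ↦ ∑ i, ∂_(a i) ∂_(b i) f + ∂_c f`. -/
def constCoeffOp {ι : Type*} [Fintype ι] (a b : ι → E) (c : E) (f : E → ℝ) (y : E) : ℝ :=
  ∑ i, dirDeriv (a i) (dirDeriv (b i) f) y + dirDeriv c f y

theorem constCoeffOp_congr {ι : Type*} [Fintype ι] (a b : ι → E) (c : E) {O : Set E}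
    (hO : IsOpen O) {f k : E → ℝ} (h : Set.EqOn f k O) :
    Set.EqOn (constCoeffOp a b c f) (constCoeffOp a b c k) O := fun y hy => by
  simp only [constCoeffOp, dirDeriv_congr hO h c hy,
    dirDeriv_congr hO (dirDeriv_congr hO h _) _ hy]

theorem dirDeriv_add {O : Set E} (hO : IsOpen O) {f k : E → ℝ} (hf : ContDiffOn ℝ ∞ f O)
    (hk : ContDiffOn ℝ ∞ k O) (a : E) :
    Set.EqOn (dirDeriv a (fun y => f y + k y)) (fun y => dirDeriv a f y + dirDeriv a k y) O :=
  fun y hy => by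
  have h1 := ((hf.contDiffAt (hO.mem_nhds hy)).differentiableAt (by simp)).hasFDerivAt
  have h2 := ((hk.contDiffAt (hO.mem_nhds hy)).differentiableAt (by simp)).hasFDerivAt
  have h3 : fderiv ℝ (fun y => f y + k y) y = _ := (h1.add h2).fderiv
  simp only [dirDeriv, h3, add_apply]

theorem dirDeriv_sum {ι : Type*} [Fintype ι] {O : Set E} (hO : IsOpen O) {f : ι → E → ℝ}
    (hf : ∀ i, ContDiffOn ℝ ∞ (f i) O) (a : E) :
    Set.EqOn (dirDeriv a (fun y => ∑ i, f i y)) (fun y => ∑ i, dirDeriv a (f i) y) O :=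
  fun y hy => by
  have h1 := fun i => (((hf i).contDiffAt (hO.mem_nhds hy)).differentiableAt (by simp)).hasFDerivAt
  have h3 : fderiv ℝ (fun y => ∑ i, f i y) y = _ :=
    (HasFDerivAt.fun_sum (u := Finset.univ) fun i _ => h1 i).fderiv
  simp only [dirDeriv, h3, sum_apply]

theorem contDiffOn_sum_dirDeriv {ι : Type*} [Fintype ι] (a b : ι → E) {O : Set E} (hO : IsOpen O)
    {f : E → ℝ} (hf : ContDiffOn ℝ ∞ f O) :
    ContDiffOn ℝ ∞ (fun y => ∑ i, dirDeriv (a i) (dirDeriv (b i) f) y) O :=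
  ContDiffOn.sum fun _ _ => contDiffOn_dirDeriv hO (contDiffOn_dirDeriv hO hf _) _

theorem contDiffOn_constCoeffOp {ι : Type*} [Fintype ι] (a b : ι → E) (c : E) {O : Set E}
    (hO : IsOpen O) {f : E → ℝ} (hf : ContDiffOn ℝ ∞ f O) :
    ContDiffOn ℝ ∞ (constCoeffOp a b c f) O :=
  (contDiffOn_sum_dirDeriv a b hO hf).add (contDiffOn_dirDeriv hO hf _)

theorem dirDeriv_constCoeffOp {ι : Type*} [Fintype ι] (a b : ι → E) (c d : E) {O : Set E}
    (hO : IsOpen O) {f : E → ℝ} (hf : ContDiffOn ℝ ∞ f O) :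
    Set.EqOn (dirDeriv d (constCoeffOp a b c f)) (constCoeffOp a b c (dirDeriv d f)) O :=
  fun y hy => by
  have h1 := dirDeriv_add hO (contDiffOn_sum_dirDeriv a b hO hf) (contDiffOn_dirDeriv hO hf c) d hy
  have h2 := dirDeriv_sum hO (fun i => contDiffOn_dirDeriv hO (contDiffOn_dirDeriv hO hf (b i))
    (a i)) d hy
  have h3 : ∀ i, dirDeriv d (dirDeriv (a i) (dirDeriv (b i) f)) y =
      dirDeriv (a i) (dirDeriv (b i) (dirDeriv d f)) y := fun i =>
    (dirDeriv_comm hO (contDiffOn_dirDeriv hO hf _) _ _ hy).trans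
      (dirDeriv_congr hO (dirDeriv_comm hO hf _ _) _ hy)
  refine h1.trans ?_
  simp only [constCoeffOp, h2, h3, dirDeriv_comm hO hf d c hy]

theorem constCoeffOp_add {ι : Type*} [Fintype ι] (a b : ι → E) (c : E) {O : Set E}
    (hO : IsOpen O) {f k : E → ℝ} (hf : ContDiffOn ℝ ∞ f O) (hk : ContDiffOn ℝ ∞ k O) :
    Set.EqOn (constCoeffOp a b c (fun y => f y + k y))
      (fun y => constCoeffOp a b c f y + constCoeffOp a b c k y) O := fun y hy => by
  have h1 : ∀ i, dirDeriv (a i) (dirDeriv (b i) (fun y => f y + k y)) y =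
      dirDeriv (a i) (dirDeriv (b i) f) y + dirDeriv (a i) (dirDeriv (b i) k) y := fun i =>
    (dirDeriv_congr hO (dirDeriv_add hO hf hk _) _ hy).trans
      (dirDeriv_add hO (contDiffOn_dirDeriv hO hf _) (contDiffOn_dirDeriv hO hk _) _ hy)
  simp only [constCoeffOp, h1, dirDeriv_add hO hf hk c hy, Finset.sum_add_distrib]
  ring

theorem constCoeffOp_sum {ι κ : Type*} [Fintype ι] [Fintype κ] (a b : ι → E) (c : E) {O : Set E}
    (hO : IsOpen O) {f : κ → E → ℝ} (hf : ∀ j, ContDiffOn ℝ ∞ (f j) O) :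
    Set.EqOn (constCoeffOp a b c (fun y => ∑ j, f j y))
      (fun y => ∑ j, constCoeffOp a b c (f j) y) O := fun y hy => by
  have h1 : ∀ i, dirDeriv (a i) (dirDeriv (b i) (fun y => ∑ j, f j y)) y =
      ∑ j, dirDeriv (a i) (dirDeriv (b i) (f j)) y := fun i =>
    (dirDeriv_congr hO (dirDeriv_sum hO hf _) _ hy).trans
      (dirDeriv_sum hO (fun j => contDiffOn_dirDeriv hO (hf j) _) _ hy)
  simp only [constCoeffOp, h1, dirDeriv_sum hO hf c hy, Finset.sum_add_distrib]
  rw [Finset.sum_comm]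

/-- By Schwarz's theorem directional derivatives of a smooth function commute, hence so do
polynomials in them with constant coefficients. -/
theorem constCoeffOp_comm {ι κ : Type*} [Fintype ι] [Fintype κ] (a b : ι → E) (c : E)
    (a' b' : κ → E) (c' : E) {O : Set E} (hO : IsOpen O) {f : E → ℝ} (hf : ContDiffOn ℝ ∞ f O) :
    Set.EqOn (constCoeffOp a b c (constCoeffOp a' b' c' f))
      (constCoeffOp a' b' c' (constCoeffOp a b c f)) O := fun y hy => by
  have h1 : ∀ i, dirDeriv (a i) (dirDeriv (b i) (constCoeffOp a' b' c' f)) y =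
      constCoeffOp a' b' c' (dirDeriv (a i) (dirDeriv (b i) f)) y := fun i =>
    (dirDeriv_congr hO (dirDeriv_constCoeffOp a' b' c' _ hO hf) _ hy).trans
      (dirDeriv_constCoeffOp a' b' c' _ hO (contDiffOn_dirDeriv hO hf _) hy)
  have h2 := constCoeffOp_add a' b' c' hO (contDiffOn_sum_dirDeriv a b hO hf)
    (contDiffOn_dirDeriv hO hf c) hy
  have h3 := constCoeffOp_sum a' b' c' hO
    (fun i => contDiffOn_dirDeriv hO (contDiffOn_dirDeriv hO hf (b i)) (a i)) hy
  refine Eq.trans ?_ h2.symm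
  simp only [h3]
  rw [constCoeffOp]
  simp only [h1, dirDeriv_constCoeffOp a' b' c' c hO hf hy]

theorem constCoeffOp_comp_affine {ι : Type*} [Fintype ι] (a b : ι → F) (c : F) (l : F →L[ℝ] E)
    (d : E) (s : F → E) (hs : ∀ x, s x = l x + d) {f : E → ℝ} {x : F}
    (hf : ContDiffAt ℝ 2 f (s x)) :
    constCoeffOp a b c (fun x => f (s x)) x =
      constCoeffOp (fun i => l (a i)) (fun i => l (b i)) (l c) f (s x) := by
  have hsc : ContDiff ℝ 2 s := by
    rw [funext hs]
    exact l.contDiff.add contDiff_const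
  have h1 : ContDiffAt ℝ 2 (fun x => f (s x)) x := hf.comp x hsc.contDiffAt
  simp only [constCoeffOp, dirDeriv_dirDeriv hf, dirDeriv_dirDeriv h1,
    fderiv_fderiv_comp_affine l d s hs hf]
  simp only [dirDeriv, fderiv_comp_affine l d s hs (hf.differentiableAt (by norm_num))]
  rfl

/-- Pushing the direction vectors forward by `inl` and `inr` turns both slice operators into
constant coefficient operators on `E × F`, where `constCoeffOp_comm` applies. -/
theorem constCoeffOp_slice_comm {ι κ : Type*} [Fintype ι] [Fintype κ] (a b : ι → E) (c : E)
    (a' b' : κ → F) (c' : F) {O : Set (E × F)} (hO : IsOpen O) {f : E × F → ℝ}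
    (hf : ContDiffOn ℝ ∞ f O) {x : E} {y : F} (hxy : (x, y) ∈ O) :
    constCoeffOp a' b' c' (fun y' => constCoeffOp a b c (fun x' => f (x', y')) x) y =
      constCoeffOp a b c (fun x' => constCoeffOp a' b' c' (fun y' => f (x', y')) y) x := by
  have two : ∀ {k : E × F → ℝ}, ContDiffOn ℝ ∞ k O → ∀ {p}, p ∈ O → ContDiffAt ℝ 2 k p :=
    fun hk _ hp => (hk.contDiffAt (hO.mem_nhds hp)).of_le two_le_infty
  have hs : ∀ (y : F) (x : E), (x, y) = ContinuousLinearMap.inl ℝ E F x + (0, y) := by simp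
  have ht : ∀ (x : E) (y : F), (x, y) = ContinuousLinearMap.inr ℝ E F y + (x, 0) := by simp
  have e1 : ∀ {k : E × F → ℝ}, ContDiffOn ℝ ∞ k O → ∀ {x y}, (x, y) ∈ O →
      constCoeffOp a b c (fun x' => k (x', y)) x = constCoeffOp
        (fun i => ContinuousLinearMap.inl ℝ E F (a i))
        (fun i => ContinuousLinearMap.inl ℝ E F (b i))
        (ContinuousLinearMap.inl ℝ E F c) k (x, y) := fun hk _ y hp =>
    constCoeffOp_comp_affine a b c _ _ _ (hs y) (two hk hp)
  have e2 : ∀ {k : E × F → ℝ}, ContDiffOn ℝ ∞ k O → ∀ {x y}, (x, y) ∈ O →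
      constCoeffOp a' b' c' (fun y' => k (x, y')) y = constCoeffOp
        (fun i => ContinuousLinearMap.inr ℝ E F (a' i))
        (fun i => ContinuousLinearMap.inr ℝ E F (b' i))
        (ContinuousLinearMap.inr ℝ E F c') k (x, y) := fun hk x _ hp =>
    constCoeffOp_comp_affine a' b' c' _ _ _ (ht x) (two hk hp)
  have o1 : IsOpen {y' | (x, y') ∈ O} := hO.preimage (by fun_prop)
  have o2 : IsOpen {x' | (x', y) ∈ O} := hO.preimage (by fun_prop)
  rw [constCoeffOp_congr a' b' c' o1 (fun y' hy' => e1 hf hy') hxy,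
    constCoeffOp_congr a b c o2 (fun x' hx' => e2 hf hx') hxy,
    e2 (contDiffOn_constCoeffOp _ _ _ hO hf) hxy, e1 (contDiffOn_constCoeffOp _ _ _ hO hf) hxy]
  exact constCoeffOp_comm _ _ _ _ _ _ hO hf hxy

/-- In a basis the trace sums the `i`-th coordinates of `S (A (e i))`. The functional `l ↦ e.coord i
(S l)` on the dual is, by reflexivity in finite dimension, evaluation at a vector `b i`. -/
theorem exists_trace_comp_eq_sum [FiniteDimensional ℝ E] (S : (E →L[ℝ] ℝ) →L[ℝ] E) :
    ∃ (r : ℕ) (a b : Fin r → E), ∀ A : E →L[ℝ] E →L[ℝ] ℝ,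
      LinearMap.trace ℝ E (S ∘L A : E →L[ℝ] E).toLinearMap = ∑ i, A (a i) (b i) := by
  let e := Module.finBasis ℝ E
  have h : ∀ i, ∃ b : E, ∀ l : E →L[ℝ] ℝ, e.coord i (S l) = l b := by
    intro i
    let m : Module.Dual ℝ (Module.Dual ℝ E) :=
      e.coord i ∘ₗ S.toLinearMap ∘ₗ (LinearMap.toContinuousLinearMap (𝕜 := ℝ) (E := E)
        (F' := ℝ)).toLinearMap
    obtain ⟨b, hb⟩ := (Module.evalEquiv ℝ E).surjective m
    refine ⟨b, fun l => ?_⟩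
    have := DFunLike.congr_fun hb l.toLinearMap
    have hl : LinearMap.toContinuousLinearMap l.toLinearMap = l := by ext; rfl
    simpa [m, hl] using this.symm
  choose b hb using h
  refine ⟨_, e, b, fun A => ?_⟩
  rw [LinearMap.trace_eq_matrix_trace ℝ e, Matrix.trace]
  refine Finset.sum_congr rfl fun i _ => ?_
  rw [← hb i, Matrix.diag_apply, LinearMap.toMatrix_apply]
  rfl

/-- Freezing of coefficients: at one point the metric and the Christoffel symbols are fixed data, so
`a`, `b`, `c` serve all `f` at once. The agreement is only at `y`. -/
theorem exists_chartLaplacian_eq_constCoeffOp [FiniteDimensional ℝ E]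
    (B : E → E →L[ℝ] E →L[ℝ] ℝ) (y : E) :
    ∃ (r : ℕ) (a b : Fin r → E) (c : E), ∀ f : E → ℝ, ContDiffAt ℝ 2 f y →
      chartLaplacian B f y = constCoeffOp a b c f y := by
  obtain ⟨r, a, b, h⟩ := exists_trace_comp_eq_sum (B y).inverse
  refine ⟨r, a, b, -∑ i, christoffel B y (a i) (b i), fun f hf => ?_⟩
  rw [chartLaplacian, h, constCoeffOp]
  simp only [dirDeriv_dirDeriv hf, hessianInChart_apply, Finset.sum_sub_distrib]
  simp only [dirDeriv, map_neg, map_sum]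
  ring

end ProductChart

/-! ### The Laplace-Beltrami operator on manifolds: chart independence, smoothness, products. -/

section LaplaceBeltrami

variable {E : Type*} [NormedAddCommGroup E] [NormedSpace ℝ E]
  {H : Type*} [TopologicalSpace H] {I : ModelWithCorners ℝ E H}
  {M : Type*} [TopologicalSpace M] [ChartedSpace H M] [IsManifold I ∞ M]
  {F : Type*} [NormedAddCommGroup F] [NormedSpace ℝ F]
  {K : Type*} [TopologicalSpace K] {J : ModelWithCorners ℝ F K}
  {N : Type*} [TopologicalSpace N] [ChartedSpace K N] [IsManifold J ∞ N]

theorem isInvertible_of_posDef [FiniteDimensional ℝ E] (B : E →L[ℝ] E →L[ℝ] ℝ)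
    (hB : ∀ v, v ≠ 0 → 0 < B v v) : B.IsInvertible := by
  have hinj : Function.Injective B.toLinearMap := by
    rw [injective_iff_map_eq_zero]
    intro v hv
    by_contra h
    have h1 : B v = 0 := hv
    have := hB v h
    simp [h1] at this
  have hd : Module.finrank ℝ E = Module.finrank ℝ (E →L[ℝ] ℝ) := by
    rw [← LinearEquiv.finrank_eq (LinearMap.toContinuousLinearMap (𝕜 := ℝ) (E := E) (F' := ℝ))]
    exact (Subspace.dual_finrank_eq (K := ℝ) (V := E)).symm
  refine ⟨(LinearMap.linearEquivOfInjective B.toLinearMap hinj hd).toContinuousLinearEquiv, ?_⟩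
  ext; rfl

theorem laplaceBeltrami_def (g : SmoothMetric I M) (f : M → ℝ) (x : M) :
    laplaceBeltrami g f x = chartLaplacian (metricInChart g x) (f ∘ (extChartAt I x).symm)
      (extChartAt I x x) := rfl

theorem metricInChart_apply (g : SmoothMetric I M) (x : M) (y u v : E) :
    metricInChart g x y u v = g.inner ((extChartAt I x).symm y)
      (mfderiv 𝓘(ℝ, E) I (extChartAt I x).symm y u)
      (mfderiv 𝓘(ℝ, E) I (extChartAt I x).symm y v) := rfl

theorem metricInChart_symm (g : SmoothMetric I M) (x : M) (y u v : E) :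
    metricInChart g x y u v = metricInChart g x y v u :=
  (metricInChart_apply g x y u v).trans
    ((g.symm _ _ _).trans (metricInChart_apply g x y v u).symm)

/-- Vectors are typed in the model space `E`, so that a change of base point does not change their
type. -/
theorem inner_congr_point (g : SmoothMetric I M) {p q : M} (h : p = q) {u u' v v' : E}
    (hu : u = u') (hv : v = v') :
    g.inner p (u : TangentSpace I p) (v : TangentSpace I p) =
      g.inner q (u' : TangentSpace I q) (v' : TangentSpace I q) := by
  subst h hu hv
  rfl

theorem extChartAt_prod_symm_apply (p : M × N) (a : E) (b : F) :
    (extChartAt (I.prod J) p).symm (a, b) =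
      ((extChartAt I p.1).symm a, (extChartAt J p.2).symm b) := by
  rw [extChartAt_prod]; rfl

section

variable [I.Boundaryless] [J.Boundaryless]

theorem isInvertible_mfderiv_extChartAt_symm (x : M) {y : E} (hy : y ∈ (extChartAt I x).target) :
    (mfderiv 𝓘(ℝ, E) I (extChartAt I x).symm y).IsInvertible := by
  have := isInvertible_mfderivWithin_extChartAt_symm (I := I) hy
  rwa [I.range_eq_univ, mfderivWithin_univ] at this

/-- The tangent space at `x` is identified with `E` through this very chart. -/
theorem mfderiv_extChartAt_symm_self (x : M) :
    (mfderiv 𝓘(ℝ, E) I (extChartAt I x).symm (extChartAt I x x) : E →L[ℝ] E) =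
      ContinuousLinearMap.id ℝ E := by
  have := mfderivWithin_range_extChartAt_symm (I := I) (x := x)
  rwa [I.range_eq_univ, mfderivWithin_univ] at this

theorem mdifferentiableAt_extChartAt_symm (x : M) {y : E} (hy : y ∈ (extChartAt I x).target) :
    MDifferentiableAt 𝓘(ℝ, E) I (extChartAt I x).symm y := by
  have := mdifferentiableWithinAt_extChartAt_symm (I := I) hy
  rwa [I.range_eq_univ, mdifferentiableWithinAt_univ] at this

theorem contMDiffAt_extChartAt_symm (x : M) {y : E} (hy : y ∈ (extChartAt I x).target) :
    ContMDiffAt 𝓘(ℝ, E) I ∞ (extChartAt I x).symm y :=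
  (contMDiffOn_extChartAt_symm x).contMDiffAt (extChartAt_target_mem_nhds' hy)

theorem metricInChart_pos (g : SmoothMetric I M) (x : M) {y : E}
    (hy : y ∈ (extChartAt I x).target) (v : E) (hv : v ≠ 0) : 0 < metricInChart g x y v v := by
  refine g.pos _ _ fun h => hv ?_
  exact (isInvertible_mfderiv_extChartAt_symm x hy).injective (h.trans (map_zero _).symm)

theorem metricInChart_isInvertible [FiniteDimensional ℝ E] (g : SmoothMetric I M) (x : M) {y : E}
    (hy : y ∈ (extChartAt I x).target) : (metricInChart g x y).IsInvertible :=
  isInvertible_of_posDef _ (metricInChart_pos g x hy)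

theorem metricInChart_self (g : SmoothMetric I M) (x : M) :
    metricInChart g x (extChartAt I x x) = (g.inner x : E →L[ℝ] E →L[ℝ] ℝ) := by
  refine ContinuousLinearMap.ext fun u => ContinuousLinearMap.ext fun v => ?_
  exact inner_congr_point g (extChartAt_to_inv (I := I) x)
    (DFunLike.congr_fun (mfderiv_extChartAt_symm_self (I := I) x) u)
    (DFunLike.congr_fun (mfderiv_extChartAt_symm_self (I := I) x) v)

/-- The tangent trivialization at `x` is inverted by the derivative of the inverse chart, so near
`x` this is the coordinate expression of the smooth section `g`. -/
theorem contDiffAt_metricInChart (g : SmoothMetric I M) (x : M) :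
    ContDiffAt ℝ ∞ (metricInChart g x) (extChartAt I x x) := by
  have hg := ((contMDiffAt_hom_bundle _).1 (g.contMDiff x)).2
  have hs := contMDiffAt_extChartAt_symm (I := I) x (mem_extChartAt_target x)
  rw [← extChartAt_to_inv (I := I) x] at hg
  have hc := hg.comp (extChartAt I x x) hs
  rw [← contMDiffAt_iff_contDiffAt]
  refine hc.congr_of_eventuallyEq ?_
  filter_upwards [extChartAt_target_mem_nhds (I := I) x] with y hy
  have hy' : (extChartAt I x).symm y ∈ (chartAt H x).source := by
    rw [← extChartAt_source I]
    exact (extChartAt I x).map_target hy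
  refine ContinuousLinearMap.ext fun u => ContinuousLinearMap.ext fun v => ?_
  have e1 := TangentBundle.symmL_trivializationAt (𝕜 := ℝ) (I := I) hy'
  rw [(extChartAt I x).right_inv hy, I.range_eq_univ, mfderivWithin_univ] at e1
  have e2 := inCoordinates_metric g.inner x ((extChartAt I x).symm y) hy' u v
  rw [e1] at e2
  simp only [Function.comp_apply, extChartAt_to_inv]
  exact e2.symm

theorem contDiffAt_comp_extChartAt_symm {n : WithTop ℕ∞} (hn : n ≤ ∞) {f : M → ℝ} (x : M) {y : E}
    (hy : y ∈ (extChartAt I x).target)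
    (hf : ContMDiffAt I 𝓘(ℝ, ℝ) n f ((extChartAt I x).symm y)) :
    ContDiffAt ℝ n (f ∘ (extChartAt I x).symm) y := by
  rw [← contMDiffAt_iff_contDiffAt]
  exact hf.comp y ((contMDiffAt_extChartAt_symm x hy).of_le hn)

/-- By definition `Δ f` uses a different chart at each point, and these charts need not vary
continuously. Here all points near `x₀` are served by the chart of `x₀`; the proof applies
`chartLaplacian_pullback` to the transition map `T`. -/
theorem laplaceBeltrami_eq_chartLaplacian [FiniteDimensional ℝ E] (g : SmoothMetric I M)
    {f : M → ℝ} (x₀ : M) {x : M} (hx : x ∈ (chartAt H x₀).source)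
    (hf : ContMDiffAt I 𝓘(ℝ, ℝ) 2 f x) :
    laplaceBeltrami g f x = chartLaplacian (metricInChart g x₀) (f ∘ (extChartAt I x₀).symm)
      (extChartAt I x₀ x) := by
  have hxs : x ∈ (extChartAt I x₀).source := by rwa [extChartAt_source]
  set y := extChartAt I x₀ x with hy
  have hyt : y ∈ (extChartAt I x₀).target := (extChartAt I x₀).map_source hxs
  have hyx : (extChartAt I x₀).symm y = x := (extChartAt I x₀).left_inv hxs
  set T : E → E := extChartAt I x ∘ (extChartAt I x₀).symm with hTdef
  have hTy : T y = extChartAt I x x := congrArg (extChartAt I x) hyx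
  have hO : ((extChartAt I x₀).symm ≫ extChartAt I x).source ∈ 𝓝 y := by
    rw [PartialEquiv.trans_source, PartialEquiv.symm_source]
    refine Filter.inter_mem (extChartAt_target_mem_nhds' hyt) ?_
    refine (mdifferentiableAt_extChartAt_symm x₀ hyt).continuousAt.preimage_mem_nhds ?_
    rw [hyx]
    exact extChartAt_source_mem_nhds x
  have hT : ContDiffAt ℝ ∞ T y := (contDiffOn_ext_coord_change (I := I) x x₀).contDiffAt hO
  have hO' := mem_interior_iff_mem_nhds.2 hO
  -- Differentiate the identity of the inverse chart at `x₀` with the inverse chart at `x` after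
  -- `T`. Points of the interior have a whole neighbourhood on which it holds.
  have hTd : ∀ z ∈ interior ((extChartAt I x₀).symm ≫ extChartAt I x).source,
      ∀ u : E, (mfderiv 𝓘(ℝ, E) I (extChartAt I x₀).symm z u : E) =
        (mfderiv 𝓘(ℝ, E) I (extChartAt I x).symm (T z) (fderiv ℝ T z u) : E) := by
    intro z hz u
    have hzn := mem_interior_iff_mem_nhds.1 hz
    have hz' := interior_subset hz
    rw [PartialEquiv.trans_source, PartialEquiv.symm_source] at hz'
    have hTz : T z ∈ (extChartAt I x).target := (extChartAt I x).map_source hz'.2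
    have dT : DifferentiableAt ℝ T z :=
      ((contDiffOn_ext_coord_change (I := I) (n := ∞) x x₀).contDiffAt hzn).differentiableAt
        (by simp)
    have h1 : HasMFDerivAt 𝓘(ℝ, E) I ((extChartAt I x).symm ∘ T) z _ :=
      (mdifferentiableAt_extChartAt_symm x hTz).hasMFDerivAt.comp z dT.hasFDerivAt.hasMFDerivAt
    have h2 : (extChartAt I x₀).symm =ᶠ[𝓝 z] (extChartAt I x).symm ∘ T := by
      filter_upwards [hzn] with w hw
      rw [PartialEquiv.trans_source, PartialEquiv.symm_source] at hw
      exact ((extChartAt I x).left_inv hw.2).symm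
    exact DFunLike.congr_fun (h1.congr_of_eventuallyEq h2).mfderiv u
  -- At `T y` the inverse chart of `x` has derivative the identity, so `DT` equals the invertible
  -- derivative of the inverse chart of `x₀`.
  have hi : (fderiv ℝ T y).IsInvertible := by
    have e1 : (mfderiv 𝓘(ℝ, E) I (extChartAt I x₀).symm y : E →L[ℝ] E) = fderiv ℝ T y := by
      refine ContinuousLinearMap.ext fun u => ?_
      refine (hTd y hO' u).trans ?_
      rw [hTy]
      exact DFunLike.congr_fun (mfderiv_extChartAt_symm_self (I := I) x) (fderiv ℝ T y u)
    rw [← e1]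
    exact isInvertible_mfderiv_extChartAt_symm x₀ hyt
  have hB' : metricInChart g x₀ =ᶠ[𝓝 y] fun z =>
      (metricInChart g x (T z)).bilinearComp (fderiv ℝ T z) (fderiv ℝ T z) := by
    filter_upwards [isOpen_interior.mem_nhds hO'] with z hz
    refine ContinuousLinearMap.ext fun u => ContinuousLinearMap.ext fun v => ?_
    have hz' := interior_subset hz
    rw [PartialEquiv.trans_source, PartialEquiv.symm_source] at hz'
    exact inner_congr_point g ((extChartAt I x).left_inv hz'.2).symm (hTd z hz u) (hTd z hz v)
  have hf' : f ∘ (extChartAt I x₀).symm =ᶠ[𝓝 y] (f ∘ (extChartAt I x).symm) ∘ T := by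
    filter_upwards [hO] with z hz
    rw [PartialEquiv.trans_source, PartialEquiv.symm_source] at hz
    exact congrArg f ((extChartAt I x).left_inv hz.2).symm
  rw [laplaceBeltrami_def, ← hTy]
  refine (chartLaplacian_pullback (hT.of_le two_le_infty) hi ?_ (metricInChart_symm g x _) ?_
    (metricInChart_isInvertible g x₀ hyt) hB' ?_ hf').symm
  · rw [hTy]
    exact (contDiffAt_metricInChart g x).differentiableAt (by simp)
  · rw [hTy]
    exact metricInChart_isInvertible g x (mem_extChartAt_target x)
  · rw [hTy]
    refine contDiffAt_comp_extChartAt_symm two_le_infty x (mem_extChartAt_target x) ?_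
    rwa [extChartAt_to_inv]

theorem contMDiffOn_laplaceBeltrami [FiniteDimensional ℝ E] (g : SmoothMetric I M)
    {f : M → ℝ} {U : Set M} (hU : IsOpen U) (hf : ContMDiffOn I 𝓘(ℝ, ℝ) ∞ f U) :
    ContMDiffOn I 𝓘(ℝ, ℝ) ∞ (laplaceBeltrami g f) U := by
  intro x hx
  refine ContMDiffAt.contMDiffWithinAt ?_
  have hfx : ContMDiffAt I 𝓘(ℝ, ℝ) ∞ f ((extChartAt I x).symm (extChartAt I x x)) := by
    rw [extChartAt_to_inv]
    exact hf.contMDiffAt (hU.mem_nhds hx)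
  have h1 := contDiffAt_chartLaplacian (contDiffAt_metricInChart g x)
    (metricInChart_isInvertible g x (mem_extChartAt_target x))
    (contDiffAt_comp_extChartAt_symm le_rfl x (mem_extChartAt_target x) hfx)
  have h2 := h1.comp_contMDiffAt (contMDiffAt_extChartAt (I := I) (n := ∞) (x := x))
  refine h2.congr_of_eventuallyEq ?_
  filter_upwards [hU.mem_nhds hx, (chartAt H x).open_source.mem_nhds (mem_chart_source H x)]
    with z hz hz'
  exact laplaceBeltrami_eq_chartLaplacian g x hz'
    ((hf.contMDiffAt (hU.mem_nhds hz)).of_le two_le_infty)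

theorem laplaceBeltrami_congr (g : SmoothMetric I M) {f k : M → ℝ} {x : M} (h : f =ᶠ[𝓝 x] k) :
    laplaceBeltrami g f x = laplaceBeltrami g k x := by
  rw [laplaceBeltrami_def, laplaceBeltrami_def]
  refine chartLaplacian_congr Filter.EventuallyEq.rfl ?_
  have hc := (mdifferentiableAt_extChartAt_symm (I := I) x
    (mem_extChartAt_target x)).continuousAt
  have : Filter.Tendsto (extChartAt I x).symm (𝓝 (extChartAt I x x)) (𝓝 x) := by
    simpa [ContinuousAt, extChartAt_to_inv] using hc
  exact this.eventually h

/-! ### Product manifolds -/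

theorem mfderiv_extChartAt_symm_prod (p : M × N) {a : E} {b : F}
    (ha : a ∈ (extChartAt I p.1).target) (hb : b ∈ (extChartAt J p.2).target) (u : E × F) :
    (mfderiv 𝓘(ℝ, E × F) (I.prod J) (extChartAt (I.prod J) p).symm (a, b) u : E × F) =
      ((mfderiv 𝓘(ℝ, E) I (extChartAt I p.1).symm a u.1 : E),
        (mfderiv 𝓘(ℝ, F) J (extChartAt J p.2).symm b u.2 : F)) := by
  have e := mfderiv_prodMap (p := (a, b)) (mdifferentiableAt_extChartAt_symm (I := I) p.1 ha)
    (mdifferentiableAt_extChartAt_symm (I := J) p.2 hb)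
  rw [extChartAt_prod, modelWithCornersSelf_prod, ← chartedSpaceSelf_prod]
  exact DFunLike.congr_fun e u

theorem metricInChart_prod (g : SmoothMetric I M) (h : SmoothMetric J N) (p : M × N) {a : E} {b : F}
    (ha : a ∈ (extChartAt I p.1).target) (hb : b ∈ (extChartAt J p.2).target) :
    metricInChart (g.prod h) p (a, b) =
      prodInner (metricInChart g p.1 a) (metricInChart h p.2 b) := by
  refine ContinuousLinearMap.ext fun u => ContinuousLinearMap.ext fun v => ?_
  rw [prodInner_apply]
  have e0 := extChartAt_prod_symm_apply (I := I) (J := J) p a b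
  have e1 := mfderiv_extChartAt_symm_prod (I := I) (J := J) p ha hb u
  have e2 := mfderiv_extChartAt_symm_prod (I := I) (J := J) p ha hb v
  have e3 := inner_congr_point (E := E × F) (I := I.prod J) (g.prod h) e0 e1 e2
  refine (metricInChart_apply (I := I.prod J) (g.prod h) p (a, b) u v).trans (e3.trans ?_)
  exact prodInner_apply (E := E) (F := F) _ _ _ _

theorem laplaceBeltrami_prod [FiniteDimensional ℝ E] [FiniteDimensional ℝ F]
    (g : SmoothMetric I M) (h : SmoothMetric J N) {f : M × N → ℝ} {x : M} {y : N}
    (hf : ContMDiffAt (I.prod J) 𝓘(ℝ, ℝ) 2 f (x, y)) :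
    laplaceBeltrami (g.prod h) f (x, y) =
      laplaceBeltrami g (fun x' => f (x', y)) x + laplaceBeltrami h (fun y' => f (x, y')) y := by
  have hf' : ContDiffAt ℝ 2 (f ∘ (extChartAt (I.prod J) (x, y)).symm)
      (extChartAt I x x, extChartAt J y y) := by
    have := contDiffAt_comp_extChartAt_symm (I := I.prod J) (f := f) two_le_infty (x, y)
      (mem_extChartAt_target (x, y)) (by rwa [extChartAt_to_inv])
    simpa [extChartAt_prod] using this
  have hm : metricInChart (g.prod h) (x, y) =ᶠ[𝓝 (extChartAt I x x, extChartAt J y y)]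
      fun q : E × F => prodInner (metricInChart g x q.1) (metricInChart h y q.2) := by
    filter_upwards [prod_mem_nhds (extChartAt_target_mem_nhds (I := I) x)
      (extChartAt_target_mem_nhds (I := J) y)] with q hq
    exact metricInChart_prod g h (x, y) hq.1 hq.2
  have key := chartLaplacian_prodInner
    ((contDiffAt_metricInChart g x).differentiableAt (by simp))
    ((contDiffAt_metricInChart h y).differentiableAt (by simp))
    (metricInChart_isInvertible g x (mem_extChartAt_target x))
    (metricInChart_isInvertible h y (mem_extChartAt_target y)) hf'
  have e1 : (fun a => (f ∘ (extChartAt (I.prod J) (x, y)).symm) (a, extChartAt J y y)) =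
      (fun x' => f (x', y)) ∘ (extChartAt I x).symm := by
    funext a
    rw [Function.comp_apply, extChartAt_prod_symm_apply, extChartAt_to_inv, Function.comp_apply]
  have e2 : (fun b => (f ∘ (extChartAt (I.prod J) (x, y)).symm) (extChartAt I x x, b)) =
      (fun y' => f (x, y')) ∘ (extChartAt J y).symm := by
    funext b
    rw [Function.comp_apply, extChartAt_prod_symm_apply, extChartAt_to_inv, Function.comp_apply]
  rw [e1, e2] at key
  refine Eq.trans ?_ key
  refine Eq.trans ?_ (chartLaplacian_congr hm Filter.EventuallyEq.rfl)
  rw [laplaceBeltrami_def, extChartAt_prod]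
  rfl

/-- The inner Laplacian is always evaluated at the same point of its factor, whatever the other
variable, so one set of frozen coefficients serves every slice. Both iterated Laplacians thus become
iterated constant coefficient operators on the function `Φ` read in the product chart. -/
theorem laplaceBeltrami_slice_comm [FiniteDimensional ℝ E] [FiniteDimensional ℝ F]
    (g : SmoothMetric I M) (h : SmoothMetric J N) {f : M × N → ℝ} {W : Set (M × N)} (hW : IsOpen W)
    (hf : ContMDiffOn (I.prod J) 𝓘(ℝ, ℝ) ∞ f W) {x : M} {y : N} (hxy : (x, y) ∈ W) :
    laplaceBeltrami h (fun y' => laplaceBeltrami g (fun x' => f (x', y')) x) y =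
      laplaceBeltrami g (fun x' => laplaceBeltrami h (fun y' => f (x', y')) y) x := by
  obtain ⟨r, a, b, c, hP⟩ :=
    exists_chartLaplacian_eq_constCoeffOp (metricInChart g x) (extChartAt I x x)
  obtain ⟨s, a', b', c', hQ⟩ :=
    exists_chartLaplacian_eq_constCoeffOp (metricInChart h y) (extChartAt J y y)
  let Φ : E × F → ℝ := fun q => f ((extChartAt I x).symm q.1, (extChartAt J y).symm q.2)
  let O : Set (E × F) := ((extChartAt I x).target ×ˢ (extChartAt J y).target) ∩
    (fun q : E × F => ((extChartAt I x).symm q.1, (extChartAt J y).symm q.2)) ⁻¹' W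
  have hTo : IsOpen ((extChartAt I x).target ×ˢ (extChartAt J y).target) :=
    (isOpen_extChartAt_target x).prod (isOpen_extChartAt_target y)
  have hsm : ∀ q ∈ (extChartAt I x).target ×ˢ (extChartAt J y).target,
      ContMDiffAt 𝓘(ℝ, E × F) (I.prod J) ∞
        (fun q : E × F => ((extChartAt I x).symm q.1, (extChartAt J y).symm q.2)) q := fun q hq =>
    ((contMDiffAt_extChartAt_symm x hq.1).comp q contDiff_fst.contMDiff.contMDiffAt).prodMk
      ((contMDiffAt_extChartAt_symm y hq.2).comp q contDiff_snd.contMDiff.contMDiffAt)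
  have hO : IsOpen O :=
    ContinuousOn.isOpen_inter_preimage
      (fun q hq => (hsm q hq).continuousAt.continuousWithinAt) hTo hW
  have hΦ : ContDiffOn ℝ ∞ Φ O := fun q hq =>
    ContDiffAt.contDiffWithinAt (contMDiffAt_iff_contDiffAt.1
      ((hf.contMDiffAt (hW.mem_nhds hq.2)).comp q (hsm q hq.1)))
  have two : ∀ {k : E × F → ℝ}, ContDiffOn ℝ ∞ k O → ∀ {p}, p ∈ O → ContDiffAt ℝ 2 k p :=
    fun hk _ hp => (hk.contDiffAt (hO.mem_nhds hp)).of_le two_le_infty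
  have hp : (extChartAt I x x, extChartAt J y y) ∈ O :=
    ⟨⟨mem_extChartAt_target x, mem_extChartAt_target y⟩, by simpa using hxy⟩
  have hs : ∀ (v : F) (u : E), (u, v) = ContinuousLinearMap.inl ℝ E F u + (0, v) := by simp
  have ht : ∀ (u : E) (v : F), (u, v) = ContinuousLinearMap.inr ℝ E F v + (u, 0) := by simp
  have cfst : ∀ (k : E × F → ℝ), ContDiffOn ℝ ∞ k O → ∀ u v, (u, v) ∈ O →
      ContDiffAt ℝ 2 (fun u' => k (u', v)) u := fun k hk u v huv =>
    ContDiffAt.comp (g := k) u (two hk huv) (contDiffAt_id.prodMk contDiffAt_const)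
  have csnd : ∀ (k : E × F → ℝ), ContDiffOn ℝ ∞ k O → ∀ u v, (u, v) ∈ O →
      ContDiffAt ℝ 2 (fun v' => k (u, v')) v := fun k hk u v huv =>
    ContDiffAt.comp (g := k) v (two hk huv) (contDiffAt_const.prodMk contDiffAt_id)
  have ev1 : ∀ᶠ v in 𝓝 (extChartAt J y y), (extChartAt I x x, v) ∈ O :=
    (hO.preimage (f := fun v => (extChartAt I x x, v)) (by fun_prop)).mem_nhds hp
  have ev2 : ∀ᶠ u in 𝓝 (extChartAt I x x), (u, extChartAt J y y) ∈ O :=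
    (hO.preimage (f := fun u => (u, extChartAt J y y)) (by fun_prop)).mem_nhds hp
  -- The outer operator may be frozen only on a `C²` function, so the inner result must be regular
  -- in the remaining variable.
  have c1 : ContDiffAt ℝ 2 (fun v => constCoeffOp a b c (fun u => Φ (u, v)) (extChartAt I x x))
      (extChartAt J y y) :=
    (csnd _ (contDiffOn_constCoeffOp _ _ _ hO hΦ) _ _ hp).congr_of_eventuallyEq
      (ev1.mono fun v hv => constCoeffOp_comp_affine a b c _ _ _ (hs v) (two hΦ hv))
  have c2 : ContDiffAt ℝ 2 (fun u => constCoeffOp a' b' c' (fun v => Φ (u, v)) (extChartAt J y y))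
      (extChartAt I x x) :=
    (cfst _ (contDiffOn_constCoeffOp _ _ _ hO hΦ) _ _ hp).congr_of_eventuallyEq
      (ev2.mono fun u hu => constCoeffOp_comp_affine a' b' c' _ _ _ (ht u) (two hΦ hu))
  have d1 : (fun y' => laplaceBeltrami g (fun x' => f (x', y')) x) ∘ (extChartAt J y).symm
      =ᶠ[𝓝 (extChartAt J y y)]
      fun v => constCoeffOp a b c (fun u => Φ (u, v)) (extChartAt I x x) :=
    ev1.mono fun v hv => hP (fun u => Φ (u, v)) (cfst Φ hΦ _ _ hv)
  have d2 : (fun x' => laplaceBeltrami h (fun y' => f (x', y')) y) ∘ (extChartAt I x).symm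
      =ᶠ[𝓝 (extChartAt I x x)]
      fun u => constCoeffOp a' b' c' (fun v => Φ (u, v)) (extChartAt J y y) :=
    ev2.mono fun u hu => hQ (fun v => Φ (u, v)) (csnd Φ hΦ _ _ hu)
  rw [laplaceBeltrami_def, chartLaplacian_congr Filter.EventuallyEq.rfl d1, hQ _ c1,
    laplaceBeltrami_def g, chartLaplacian_congr Filter.EventuallyEq.rfl d2, hP _ c2]
  exact constCoeffOp_slice_comm a b c a' b' c' hO hΦ hp

end

end LaplaceBeltrami

/-! ### Smoothness of the quartic test functions. -/

section SmoothFunctions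

variable {E : Type*} [NormedAddCommGroup E] [NormedSpace ℝ E]
  {H : Type*} [TopologicalSpace H] {I : ModelWithCorners ℝ E H}
  {M : Type*} [TopologicalSpace M] [ChartedSpace H M] {f k : M → ℝ}

theorem ContMDiff.mul_real (hf : ContMDiff I 𝓘(ℝ, ℝ) ∞ f) (hk : ContMDiff I 𝓘(ℝ, ℝ) ∞ k) :
    ContMDiff I 𝓘(ℝ, ℝ) ∞ (fun x => f x * k x) :=
  hf.mul hk

theorem ContMDiff.add_real (hf : ContMDiff I 𝓘(ℝ, ℝ) ∞ f) (hk : ContMDiff I 𝓘(ℝ, ℝ) ∞ k) :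
    ContMDiff I 𝓘(ℝ, ℝ) ∞ (fun x => f x + k x) :=
  hf.add hk

theorem ContMDiff.sub_real (hf : ContMDiff I 𝓘(ℝ, ℝ) ∞ f) (hk : ContMDiff I 𝓘(ℝ, ℝ) ∞ k) :
    ContMDiff I 𝓘(ℝ, ℝ) ∞ (fun x => f x - k x) :=
  hf.sub hk

theorem ContMDiff.const_mul_real (hf : ContMDiff I 𝓘(ℝ, ℝ) ∞ f) (c : ℝ) :
    ContMDiff I 𝓘(ℝ, ℝ) ∞ (fun x => c * f x) :=
  contMDiff_const.mul hf

/-- The real part of `(a + b i) ^ 4`. -/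
def reQuartic {X : Type*} (a b : X → ℝ) (x : X) : ℝ :=
  a x * a x * (a x * a x) - 6 * (a x * a x * (b x * b x)) + b x * b x * (b x * b x)

/-- A quarter of the imaginary part of `(a + b i) ^ 4`. -/
def imQuartic {X : Type*} (a b : X → ℝ) (x : X) : ℝ :=
  a x * a x * (a x * b x) - b x * b x * (a x * b x)

theorem contMDiff_reQuartic {a b : M → ℝ} (ha : ContMDiff I 𝓘(ℝ, ℝ) ∞ a)
    (hb : ContMDiff I 𝓘(ℝ, ℝ) ∞ b) : ContMDiff I 𝓘(ℝ, ℝ) ∞ (reQuartic a b) :=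
  (((ha.mul_real ha).mul_real (ha.mul_real ha)).sub_real
    (((ha.mul_real ha).mul_real (hb.mul_real hb)).const_mul_real 6)).add_real
    ((hb.mul_real hb).mul_real (hb.mul_real hb))

theorem contMDiff_imQuartic {a b : M → ℝ} (ha : ContMDiff I 𝓘(ℝ, ℝ) ∞ a)
    (hb : ContMDiff I 𝓘(ℝ, ℝ) ∞ b) : ContMDiff I 𝓘(ℝ, ℝ) ∞ (imQuartic a b) :=
  ((ha.mul_real ha).mul_real (ha.mul_real hb)).sub_real ((hb.mul_real hb).mul_real (ha.mul_real hb))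

end SmoothFunctions

/-! ### Leibniz rules on a manifold and the bilaplacian of quartics at a common zero. -/

section Leibniz

variable {E : Type*} [NormedAddCommGroup E] [NormedSpace ℝ E]
  {H : Type*} [TopologicalSpace H] {I : ModelWithCorners ℝ E H} [I.Boundaryless]
  {M : Type*} [TopologicalSpace M] [ChartedSpace H M] [IsManifold I ∞ M]

/-- The inner product `⟨∇f, ∇k⟩` of the gradients of two functions, in the preferred chart. -/
def gradInner (g : SmoothMetric I M) (f k : M → ℝ) (x : M) : ℝ :=
  fderiv ℝ (f ∘ (extChartAt I x).symm) (extChartAt I x x)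
    ((metricInChart g x (extChartAt I x x)).inverse
      (fderiv ℝ (k ∘ (extChartAt I x).symm) (extChartAt I x x)))

theorem contDiffAt_two_of_contMDiff {f : M → ℝ} (hf : ContMDiff I 𝓘(ℝ, ℝ) ∞ f) (x : M) :
    ContDiffAt ℝ 2 (f ∘ (extChartAt I x).symm) (extChartAt I x x) :=
  contDiffAt_comp_extChartAt_symm two_le_infty x (mem_extChartAt_target x)
    ((hf _).of_le two_le_infty)

variable [FiniteDimensional ℝ E] (g : SmoothMetric I M) {f k l : M → ℝ}

theorem gradInner_comm (f k : M → ℝ) (x : M) : gradInner g f k x = gradInner g k f x := by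
  have hi := metricInChart_isInvertible g x (mem_extChartAt_target (I := I) x)
  have hs := metricInChart_symm g x (extChartAt I x x)
  obtain ⟨u, hu⟩ := hi.surjective (fderiv ℝ (f ∘ (extChartAt I x).symm) (extChartAt I x x))
  obtain ⟨v, hv⟩ := hi.surjective (fderiv ℝ (k ∘ (extChartAt I x).symm) (extChartAt I x x))
  rw [gradInner, gradInner, ← hu, ← hv, hi.inverse_apply_self, hi.inverse_apply_self, hs]

theorem gradInner_mul_left (hf : ContMDiff I 𝓘(ℝ, ℝ) ∞ f) (hk : ContMDiff I 𝓘(ℝ, ℝ) ∞ k)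
    (l : M → ℝ) (x : M) :
    gradInner g (fun x => f x * k x) l x = f x * gradInner g k l x + k x * gradInner g f l x := by
  have h1 := (contDiffAt_two_of_contMDiff hf x).differentiableAt (by norm_num)
  have h2 := (contDiffAt_two_of_contMDiff hk x).differentiableAt (by norm_num)
  have h3 : fderiv ℝ ((fun x => f x * k x) ∘ (extChartAt I x).symm) (extChartAt I x x) = _ :=
    (h1.hasFDerivAt.mul h2.hasFDerivAt).fderiv
  rw [gradInner, h3]
  simp [gradInner]

theorem gradInner_mul_right (hf : ContMDiff I 𝓘(ℝ, ℝ) ∞ f) (hk : ContMDiff I 𝓘(ℝ, ℝ) ∞ k)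
    (l : M → ℝ) (x : M) :
    gradInner g l (fun x => f x * k x) x = f x * gradInner g l k x + k x * gradInner g l f x := by
  rw [gradInner_comm, gradInner_mul_left g hf hk, gradInner_comm g k, gradInner_comm g f]

theorem laplaceBeltrami_mul (hf : ContMDiff I 𝓘(ℝ, ℝ) ∞ f) (hk : ContMDiff I 𝓘(ℝ, ℝ) ∞ k) (x : M) :
    laplaceBeltrami g (fun x => f x * k x) x =
      f x * laplaceBeltrami g k x + k x * laplaceBeltrami g f x + 2 * gradInner g f k x := by
  have h := chartLaplacian_mul (metricInChart g x) (contDiffAt_two_of_contMDiff hf x)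
    (contDiffAt_two_of_contMDiff hk x)
  have h1 : gradInner g f k x + gradInner g k f x = 2 * gradInner g f k x := by
    rw [gradInner_comm g k f]; ring
  rw [← h1]
  simpa only [Function.comp_apply, extChartAt_to_inv] using! h

theorem laplaceBeltrami_add (hf : ContMDiff I 𝓘(ℝ, ℝ) ∞ f) (hk : ContMDiff I 𝓘(ℝ, ℝ) ∞ k) (x : M) :
    laplaceBeltrami g (fun x => f x + k x) x = laplaceBeltrami g f x + laplaceBeltrami g k x :=
  chartLaplacian_add (metricInChart g x) (contDiffAt_two_of_contMDiff hf x)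
    (contDiffAt_two_of_contMDiff hk x)

theorem laplaceBeltrami_const (c : ℝ) (x : M) : laplaceBeltrami g (fun _ => c) x = 0 :=
  chartLaplacian_const (metricInChart g x) c (extChartAt I x x)

theorem laplaceBeltrami_const_mul (c : ℝ) (hf : ContMDiff I 𝓘(ℝ, ℝ) ∞ f) (x : M) :
    laplaceBeltrami g (fun x => c * f x) x = c * laplaceBeltrami g f x := by
  rw [laplaceBeltrami_mul g contMDiff_const hf, laplaceBeltrami_const]
  have : gradInner g (fun _ => c) f x = 0 := by
    have e : fderiv ℝ ((fun _ : M => c) ∘ (extChartAt I x).symm) (extChartAt I x x) = 0 :=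
      fderiv_const_apply c
    rw [gradInner, e]
    rfl
  rw [this]
  ring

theorem laplaceBeltrami_sub (hf : ContMDiff I 𝓘(ℝ, ℝ) ∞ f) (hk : ContMDiff I 𝓘(ℝ, ℝ) ∞ k) (x : M) :
    laplaceBeltrami g (fun x => f x - k x) x = laplaceBeltrami g f x - laplaceBeltrami g k x := by
  have h1 := laplaceBeltrami_add g hf (hk.const_mul_real (-1)) x
  rw [laplaceBeltrami_const_mul g (-1) hk] at h1
  have e : (fun x => f x - k x) = fun x => f x + -1 * k x := by funext x; ring
  rw [e, h1]
  ring

theorem contMDiff_laplaceBeltrami (hf : ContMDiff I 𝓘(ℝ, ℝ) ∞ f) :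
    ContMDiff I 𝓘(ℝ, ℝ) ∞ (laplaceBeltrami g f) :=
  contMDiffOn_univ.1 (contMDiffOn_laplaceBeltrami g isOpen_univ (contMDiffOn_univ.2 hf))

/-- The definition uses a chart that changes with the point; expressing the gradient product through
`Δ (f k)`, `Δ f` and `Δ k` reduces smoothness to that of Laplacians. -/
theorem contMDiff_gradInner (hf : ContMDiff I 𝓘(ℝ, ℝ) ∞ f) (hk : ContMDiff I 𝓘(ℝ, ℝ) ∞ k) :
    ContMDiff I 𝓘(ℝ, ℝ) ∞ (gradInner g f k) := by
  have e : gradInner g f k = fun x => (1 / 2 : ℝ) * (laplaceBeltrami g (fun x => f x * k x) x -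
      (f x * laplaceBeltrami g k x + k x * laplaceBeltrami g f x)) := by
    funext x
    rw [laplaceBeltrami_mul g hf hk]
    ring
  rw [e]
  exact ((contMDiff_laplaceBeltrami g (hf.mul_real hk)).sub_real
    ((hf.mul_real (contMDiff_laplaceBeltrami g hk)).add_real
    (hk.mul_real (contMDiff_laplaceBeltrami g hf)))).const_mul_real (1 / 2)

/-- At a common zero of `f` and `k` a term survives only if each of them receives exactly one
derivative. -/
theorem laplaceBeltrami_mul_mul_of_eq_zero (hf : ContMDiff I 𝓘(ℝ, ℝ) ∞ f)
    (hk : ContMDiff I 𝓘(ℝ, ℝ) ∞ k) (hl : ContMDiff I 𝓘(ℝ, ℝ) ∞ l) {x : M}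
    (hfx : f x = 0) (hkx : k x = 0) :
    laplaceBeltrami g (fun x => f x * k x * l x) x = 2 * gradInner g f k x * l x := by
  rw [laplaceBeltrami_mul g (hf.mul_real hk) hl, laplaceBeltrami_mul g hf hk,
    gradInner_mul_left g hf hk, hfx, hkx]
  ring

theorem laplaceBeltrami_quadratic_of_eq_zero {a b p q r : M → ℝ} (ha : ContMDiff I 𝓘(ℝ, ℝ) ∞ a)
    (hb : ContMDiff I 𝓘(ℝ, ℝ) ∞ b) (hp : ContMDiff I 𝓘(ℝ, ℝ) ∞ p) (hq : ContMDiff I 𝓘(ℝ, ℝ) ∞ q)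
    (hr : ContMDiff I 𝓘(ℝ, ℝ) ∞ r) {x : M} (hax : a x = 0) (hbx : b x = 0) :
    laplaceBeltrami g (fun x => a x * a x * p x + a x * b x * q x + b x * b x * r x) x =
      2 * (gradInner g a a x * p x + gradInner g a b x * q x + gradInner g b b x * r x) := by
  rw [laplaceBeltrami_add g (((ha.mul_real ha).mul_real hp).add_real ((ha.mul_real hb).mul_real hq))
      ((hb.mul_real hb).mul_real hr),
    laplaceBeltrami_add g ((ha.mul_real ha).mul_real hp) ((ha.mul_real hb).mul_real hq),
    laplaceBeltrami_mul_mul_of_eq_zero g ha ha hp hax hax,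
    laplaceBeltrami_mul_mul_of_eq_zero g ha hb hq hax hbx,
    laplaceBeltrami_mul_mul_of_eq_zero g hb hb hr hbx hbx]
  ring

/-- Arranged as a quadratic form in `a`, `b` so that `laplaceBeltrami_quadratic_of_eq_zero` handles
the second Laplacian. It also shows harmonicity when `a`, `b` are harmonic with orthonormal
gradients. -/
theorem laplaceBeltrami_reQuartic {a b : M → ℝ} (ha : ContMDiff I 𝓘(ℝ, ℝ) ∞ a)
    (hb : ContMDiff I 𝓘(ℝ, ℝ) ∞ b) (x : M) :
    laplaceBeltrami g (reQuartic a b) x =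
      a x * a x * (4 * (a x * laplaceBeltrami g a x) - 12 * (b x * laplaceBeltrami g b x) +
        (12 * gradInner g a a x - 12 * gradInner g b b x)) +
      a x * b x * (-12 * (b x * laplaceBeltrami g a x) - 48 * gradInner g a b x) +
      b x * b x * (4 * (b x * laplaceBeltrami g b x) +
        (12 * gradInner g b b x - 12 * gradInner g a a x)) := by
  have haa := ha.mul_real ha
  have hbb := hb.mul_real hb
  have e : reQuartic a b = fun x => a x * a x * (a x * a x) - 6 * (a x * a x * (b x * b x)) +
    b x * b x * (b x * b x) := rfl
  rw [e, laplaceBeltrami_add g ((haa.mul_real haa).sub_real ((haa.mul_real hbb).const_mul_real 6))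
      (hbb.mul_real hbb),
    laplaceBeltrami_sub g (haa.mul_real haa) ((haa.mul_real hbb).const_mul_real 6),
    laplaceBeltrami_const_mul g 6 (haa.mul_real hbb), laplaceBeltrami_mul g haa haa,
    laplaceBeltrami_mul g haa hbb, laplaceBeltrami_mul g hbb hbb, laplaceBeltrami_mul g ha ha,
    laplaceBeltrami_mul g hb hb]
  simp only [gradInner_mul_left g ha ha, gradInner_mul_left g hb hb, gradInner_mul_right g ha ha,
    gradInner_mul_right g hb hb]
  ring

theorem laplaceBeltrami_imQuartic {a b : M → ℝ} (ha : ContMDiff I 𝓘(ℝ, ℝ) ∞ a)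
    (hb : ContMDiff I 𝓘(ℝ, ℝ) ∞ b) (x : M) :
    laplaceBeltrami g (imQuartic a b) x =
      a x * a x * (3 * (b x * laplaceBeltrami g a x) + a x * laplaceBeltrami g b x +
        6 * gradInner g a b x) +
      a x * b x * (-3 * (b x * laplaceBeltrami g b x) +
        (6 * gradInner g a a x - 6 * gradInner g b b x)) +
      b x * b x * (-1 * (b x * laplaceBeltrami g a x) - 6 * gradInner g a b x) := by
  have haa := ha.mul_real ha
  have hbb := hb.mul_real hb
  have hab := ha.mul_real hb
  have e : imQuartic a b = fun x => a x * a x * (a x * b x) - b x * b x * (a x * b x) := rfl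
  rw [e, laplaceBeltrami_sub g (haa.mul_real hab) (hbb.mul_real hab), laplaceBeltrami_mul g haa hab,
    laplaceBeltrami_mul g hbb hab, laplaceBeltrami_mul g ha ha, laplaceBeltrami_mul g hb hb,
    laplaceBeltrami_mul g ha hb]
  simp only [gradInner_mul_left g ha ha, gradInner_mul_left g hb hb, gradInner_mul_right g ha hb,
    gradInner_comm g b a]
  ring

/-- Every `Δ a` or `Δ b` in the coefficients of that quadratic form carries a factor `a` or `b` and
dies at the zero; only gradient products remain. -/
theorem bilaplacian_reQuartic_of_eq_zero {a b : M → ℝ} (ha : ContMDiff I 𝓘(ℝ, ℝ) ∞ a)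
    (hb : ContMDiff I 𝓘(ℝ, ℝ) ∞ b) {x : M} (hax : a x = 0) (hbx : b x = 0) :
    laplaceBeltrami g (laplaceBeltrami g (reQuartic a b)) x =
      24 * ((gradInner g a a x - gradInner g b b x) ^ 2 - 4 * gradInner g a b x ^ 2) := by
  have hla := contMDiff_laplaceBeltrami g ha
  have hlb := contMDiff_laplaceBeltrami g hb
  have gaa := contMDiff_gradInner g ha ha
  have gab := contMDiff_gradInner g ha hb
  have gbb := contMDiff_gradInner g hb hb
  rw [funext (laplaceBeltrami_reQuartic g ha hb), laplaceBeltrami_quadratic_of_eq_zero g ha hb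
    ((((ha.mul_real hla).const_mul_real 4).sub_real ((hb.mul_real hlb).const_mul_real 12)).add_real
      ((gaa.const_mul_real 12).sub_real (gbb.const_mul_real 12)))
    (((hb.mul_real hla).const_mul_real (-12)).sub_real (gab.const_mul_real 48))
    (((hb.mul_real hlb).const_mul_real 4).add_real
      ((gbb.const_mul_real 12).sub_real (gaa.const_mul_real 12))) hax hbx, hax, hbx]
  ring

theorem bilaplacian_imQuartic_of_eq_zero {a b : M → ℝ} (ha : ContMDiff I 𝓘(ℝ, ℝ) ∞ a)
    (hb : ContMDiff I 𝓘(ℝ, ℝ) ∞ b) {x : M} (hax : a x = 0) (hbx : b x = 0) :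
    laplaceBeltrami g (laplaceBeltrami g (imQuartic a b)) x =
      24 * (gradInner g a b x * (gradInner g a a x - gradInner g b b x)) := by
  have hla := contMDiff_laplaceBeltrami g ha
  have hlb := contMDiff_laplaceBeltrami g hb
  have gaa := contMDiff_gradInner g ha ha
  have gab := contMDiff_gradInner g ha hb
  have gbb := contMDiff_gradInner g hb hb
  rw [funext (laplaceBeltrami_imQuartic g ha hb), laplaceBeltrami_quadratic_of_eq_zero g ha hb
    ((((hb.mul_real hla).const_mul_real 3).add_real (ha.mul_real hlb)).add_real
      (gab.const_mul_real 6))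
    (((hb.mul_real hlb).const_mul_real (-3)).add_real
      ((gaa.const_mul_real 6).sub_real (gbb.const_mul_real 6)))
    (((hb.mul_real hla).const_mul_real (-1)).sub_real (gab.const_mul_real 6)) hax hbx, hax, hbx]
  ring

end Leibniz

/-! ### The Euclidean target: translations and harmonic test functions. -/

section Euclidean

variable {k : ℕ}

theorem metricInChart_euclideanMetric (x : EuclideanSpace ℝ (Fin k)) :
    metricInChart (euclideanMetric k) x =
      fun _ => (innerSL ℝ : EuclideanSpace ℝ (Fin k) →L[ℝ] EuclideanSpace ℝ (Fin k) →L[ℝ] ℝ) := by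
  funext y
  refine ContinuousLinearMap.ext fun u => ContinuousLinearMap.ext fun v => ?_
  have e : ∀ u : EuclideanSpace ℝ (Fin k),
      mfderiv 𝓘(ℝ, EuclideanSpace ℝ (Fin k)) 𝓘(ℝ, EuclideanSpace ℝ (Fin k))
      (extChartAt 𝓘(ℝ, EuclideanSpace ℝ (Fin k)) x).symm y u = u := by
    intro u
    rw [extChartAt_model_space_eq_id]
    exact DFunLike.congr_fun (mfderiv_id (I := 𝓘(ℝ, EuclideanSpace ℝ (Fin k))) (x := y)) u
  refine (metricInChart_apply _ _ _ _ _).trans ?_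
  rw [e, e]
  rfl

theorem laplaceBeltrami_euclideanMetric (f : EuclideanSpace ℝ (Fin k) → ℝ)
    (x : EuclideanSpace ℝ (Fin k)) :
    laplaceBeltrami (euclideanMetric k) f x = chartLaplacian (fun _ => innerSL ℝ) f x := by
  rw [laplaceBeltrami_def, metricInChart_euclideanMetric, extChartAt_model_space_eq_id]
  rfl

theorem hessianInChart_const_metric {E : Type*} [NormedAddCommGroup E] [NormedSpace ℝ E]
    (B : E →L[ℝ] E →L[ℝ] ℝ) (f : E → ℝ) (y : E) :
    hessianInChart (fun _ => B) f y = fderiv ℝ (fderiv ℝ f) y := by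
  ext u v
  have : koszulForm (fun _ => B) y u v = 0 := by ext w; simp [koszulForm_apply]
  simp [hessianInChart_apply, christoffel_apply, this]

theorem laplaceBeltrami_euclideanMetric_comp_add (f : EuclideanSpace ℝ (Fin k) → ℝ)
    (x c : EuclideanSpace ℝ (Fin k)) :
    laplaceBeltrami (euclideanMetric k) (fun y => f (y + c)) x =
      laplaceBeltrami (euclideanMetric k) f (x + c) := by
  rw [laplaceBeltrami_euclideanMetric, laplaceBeltrami_euclideanMetric, chartLaplacian,
    chartLaplacian, hessianInChart_const_metric, hessianInChart_const_metric]
  have e : fderiv ℝ (fun y => f (y + c)) = fun y => fderiv ℝ f (y + c) := by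
    funext y; exact fderiv_comp_add_right c
  rw [e, fderiv_comp_add_right]

/-- Freezing one variable of the direct sum replaces the test function by such a translate. -/
theorem isHarmonicOn_comp_add {f : EuclideanSpace ℝ (Fin k) → ℝ}
    {U : Set (EuclideanSpace ℝ (Fin k))} (hf : IsHarmonicOn (euclideanMetric k) f U)
    (c : EuclideanSpace ℝ (Fin k)) :
    IsHarmonicOn (euclideanMetric k) (fun y => f (y + c)) ((fun y => y + c) ⁻¹' U) := by
  refine ⟨?_, fun x hx => ?_⟩
  · exact hf.1.comp (contDiff_id.add contDiff_const).contMDiff.contMDiffOn fun _ h => h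
  · rw [laplaceBeltrami_euclideanMetric_comp_add]
    exact hf.2 _ hx

theorem contMDiff_coord_sub (c : ℝ) (i : Fin k) :
    ContMDiff 𝓘(ℝ, EuclideanSpace ℝ (Fin k)) 𝓘(ℝ, ℝ) ∞
      (fun y : EuclideanSpace ℝ (Fin k) => y i - c) :=
  ((EuclideanSpace.proj i : EuclideanSpace ℝ (Fin k) →L[ℝ] ℝ).contDiff.sub
    contDiff_const).contMDiff

theorem fderiv_coord_sub (c : ℝ) (i : Fin k) (y : EuclideanSpace ℝ (Fin k)) :
    fderiv ℝ (fun y : EuclideanSpace ℝ (Fin k) => y i - c) y = EuclideanSpace.proj i :=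
  ((EuclideanSpace.proj i : EuclideanSpace ℝ (Fin k) →L[ℝ] ℝ).hasFDerivAt.sub_const c).fderiv

theorem laplaceBeltrami_coord_sub (c : ℝ) (i : Fin k) (y : EuclideanSpace ℝ (Fin k)) :
    laplaceBeltrami (euclideanMetric k) (fun y => y i - c) y = 0 := by
  rw [laplaceBeltrami_euclideanMetric, chartLaplacian, hessianInChart_const_metric,
    funext (fderiv_coord_sub c i)]
  simp

theorem gradInner_coord_sub (c d : ℝ) (i j : Fin k) (y : EuclideanSpace ℝ (Fin k)) :
    gradInner (euclideanMetric k) (fun y => y i - c) (fun y => y j - d) y =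
      if i = j then 1 else 0 := by
  have hi := metricInChart_isInvertible (euclideanMetric k) y (mem_extChartAt_target y)
  rw [metricInChart_euclideanMetric] at hi
  have e : (innerSL ℝ : EuclideanSpace ℝ (Fin k) →L[ℝ] EuclideanSpace ℝ (Fin k) →L[ℝ] ℝ).inverse
      (EuclideanSpace.proj j) = EuclideanSpace.single j 1 := by
    rw [hi.inverse_apply_eq]
    ext v
    rw [innerSL_apply_apply, EuclideanSpace.inner_single_left]
    simp
  rw [gradInner, metricInChart_euclideanMetric, extChartAt_model_space_eq_id]
  simp only [PartialEquiv.refl_symm, PartialEquiv.refl_coe, Function.comp_id, id_eq,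
    fderiv_coord_sub, e]
  simp

theorem isHarmonicOn_reQuartic {i j : Fin k} (hij : i ≠ j) (c d : ℝ) :
    IsHarmonicOn (euclideanMetric k)
      (reQuartic (fun y : EuclideanSpace ℝ (Fin k) => y i - c) (fun y => y j - d)) Set.univ := by
  refine ⟨(contMDiff_reQuartic (contMDiff_coord_sub c i)
    (contMDiff_coord_sub d j)).contMDiffOn, fun y _ => ?_⟩
  rw [laplaceBeltrami_reQuartic _ (contMDiff_coord_sub c i) (contMDiff_coord_sub d j)]
  simp only [laplaceBeltrami_coord_sub, gradInner_coord_sub, hij, if_true, if_false]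
  ring

theorem isHarmonicOn_imQuartic {i j : Fin k} (hij : i ≠ j) (c d : ℝ) :
    IsHarmonicOn (euclideanMetric k)
      (imQuartic (fun y : EuclideanSpace ℝ (Fin k) => y i - c) (fun y => y j - d)) Set.univ := by
  refine ⟨(contMDiff_imQuartic (contMDiff_coord_sub c i)
    (contMDiff_coord_sub d j)).contMDiffOn, fun y _ => ?_⟩
  rw [laplaceBeltrami_imQuartic _ (contMDiff_coord_sub c i) (contMDiff_coord_sub d j)]
  simp only [laplaceBeltrami_coord_sub, gradInner_coord_sub, hij, if_true, if_false]
  ring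

theorem isHarmonicOn_coord (i : Fin k) :
    IsHarmonicOn (euclideanMetric k) (fun y => y i) Set.univ := by
  have h1 := contMDiff_coord_sub (k := k) 0 i
  have h2 := laplaceBeltrami_coord_sub (k := k) 0 i
  simp only [sub_zero] at h1 h2
  exact ⟨h1.contMDiffOn, fun y _ => h2 y⟩

end Euclidean

/-! ### Generalized harmonic morphisms, conformality and the direct sum. -/

section Morphisms

variable {E : Type*} [NormedAddCommGroup E] [NormedSpace ℝ E]
  {H : Type*} [TopologicalSpace H] {I : ModelWithCorners ℝ E H}
  {M : Type*} [TopologicalSpace M] [ChartedSpace H M] [IsManifold I ∞ M]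
  {F : Type*} [NormedAddCommGroup F] [NormedSpace ℝ F]
  {K : Type*} [TopologicalSpace K] {J : ModelWithCorners ℝ F K}
  {N : Type*} [TopologicalSpace N] [ChartedSpace K N] [IsManifold J ∞ N]

/-- If the gradients of the components of a linear map into `ℝᵏ` are pairwise orthogonal and of
equal length, then the map is zero or a surjective homothety on the complement of its kernel. -/
theorem exists_dilation_of_orthogonal_gradients {k : ℕ}
    (G : E →L[ℝ] E →L[ℝ] ℝ) (hp : ∀ v, v ≠ 0 → 0 < G v v)
    (A : E →L[ℝ] EuclideanSpace ℝ (Fin k)) (grad : Fin k → E)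
    (hgrad : ∀ i v, G (grad i) v = A v i)
    (hA : ∀ i j, i ≠ j → A (grad i) i = A (grad j) j ∧ A (grad j) i = 0) :
    ∃ d : ℝ, (A = 0 ∧ d = 0) ∨ (0 < d ∧ Function.Surjective A ∧
      ∀ X Y, (∀ V, A V = 0 → G X V = 0) → (∀ V, A V = 0 → G Y V = 0) →
        inner ℝ (A X) (A Y) = d ^ 2 * G X Y) := by
  by_cases h0 : ∀ i, A (grad i) i = 0
  · refine ⟨0, Or.inl ⟨?_, rfl⟩⟩
    ext v i
    have hi : grad i = 0 := by
      by_contra hne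
      have := hp _ hne
      rw [hgrad, h0] at this
      exact lt_irrefl _ this
    rw [← hgrad i v, hi]
    simp
  · push Not at h0
    obtain ⟨i₀, hi₀⟩ := h0
    -- The common squared length of the gradients, which becomes the square of the dilation.
    set c := A (grad i₀) i₀ with hc
    have hcpos : 0 < c := by
      rw [hc, ← hgrad]
      refine hp _ fun h => hi₀ ?_
      rw [hc, h]
      simp
    have hd : ∀ i j, A (grad j) i = if i = j then c else 0 := by
      intro i j
      split_ifs with h
      · subst h
        by_cases h' : i = i₀
        · rw [h']
        · exact (hA i i₀ h').1
      · exact (hA i j h).2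
    -- The gradients are orthogonal of squared length `c`, so dividing by `c` gives a right inverse
    -- of `A`.
    have hlin : ∀ w : EuclideanSpace ℝ (Fin k), A (∑ j, (w j / c) • grad j) = w := by
      intro w
      ext i
      simp only [map_sum, map_smul, WithLp.ofLp_sum, WithLp.ofLp_smul, Finset.sum_apply,
        Pi.smul_apply, hd, smul_eq_mul, mul_ite, mul_zero, Finset.sum_ite_eq, Finset.mem_univ,
        if_true]
      field_simp
    have hG : ∀ (w : EuclideanSpace ℝ (Fin k)) v,
        G (∑ j, (w j / c) • grad j) v = ∑ j, w j / c * A v j := by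
      intro w v
      simp [hgrad]
    refine ⟨√c, Or.inr ⟨Real.sqrt_pos.2 hcpos, fun w => ⟨_, hlin w⟩, fun X Y hX _ => ?_⟩⟩
    -- The difference lies in the kernel of `A`, and both `X` and the span of the gradients are
    -- orthogonal to that kernel; so the difference has length zero.
    have hXeq : X = ∑ j, (A X j / c) • grad j := by
      by_contra hne
      have hker : A (X - ∑ j, (A X j / c) • grad j) = 0 := by rw [map_sub, hlin, sub_self]
      have hpos := hp _ (sub_ne_zero.2 hne)
      have e : G (X - ∑ j, (A X j / c) • grad j) (X - ∑ j, (A X j / c) • grad j) =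
          G X (X - ∑ j, (A X j / c) • grad j) -
            G (∑ j, (A X j / c) • grad j) (X - ∑ j, (A X j / c) • grad j) := by
        rw [map_sub G]; rfl
      rw [e, hX _ hker, hG, hker] at hpos
      simp at hpos
    rw [Real.sq_sqrt hcpos.le]
    conv_rhs => rw [hXeq]
    rw [hG, Finset.mul_sum, PiLp.inner_apply]
    refine Finset.sum_congr rfl fun j _ => ?_
    simp
    field_simp

/-- Up to a factor `4` in the second, these are the real and imaginary parts of `(a - b + 2 c √-1) ^
2 = 0`. -/
theorem eq_of_quartic_relations {a b c : ℝ} (h1 : (a - b) ^ 2 - 4 * c ^ 2 = 0)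
    (h2 : c * (a - b) = 0) : a = b ∧ c = 0 := by
  rcases mul_eq_zero.1 h2 with h | h
  · have : (a - b) ^ 2 = 0 := by rw [h] at h1; linarith
    exact ⟨sub_eq_zero.1 (pow_eq_zero_iff two_ne_zero |>.1 this), h⟩
  · have : c ^ 2 = 0 := by rw [h] at h1; linarith
    exact ⟨sub_eq_zero.1 h, pow_eq_zero_iff two_ne_zero |>.1 this⟩

theorem contMDiff_component {k : ℕ} {ψ : M → EuclideanSpace ℝ (Fin k)}
    (hψ : ContMDiff I 𝓘(ℝ, EuclideanSpace ℝ (Fin k)) ∞ ψ) (c : ℝ) (i : Fin k) :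
    ContMDiff I 𝓘(ℝ, ℝ) ∞ (fun x => ψ x i - c) :=
  (contMDiff_coord_sub c i).comp hψ

theorem IsGeneralizedHarmonicMorphism.isHorizontallyWeaklyConformal [I.Boundaryless]
    [FiniteDimensional ℝ E] {g : SmoothMetric I M} {k : ℕ} {ψ : M → EuclideanSpace ℝ (Fin k)}
    (hψ : IsGeneralizedHarmonicMorphism g (euclideanMetric k) ψ) :
    IsHorizontallyWeaklyConformal g (euclideanMetric k) ψ := by
  refine ⟨hψ.1, ?_⟩
  have key : ∀ x : M, ∃ d : ℝ,
      (mfderiv I 𝓘(ℝ, EuclideanSpace ℝ (Fin k)) ψ x = 0 ∧ d = 0) ∨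
      (0 < d ∧ Function.Surjective (mfderiv I 𝓘(ℝ, EuclideanSpace ℝ (Fin k)) ψ x) ∧
        ∀ X Y : TangentSpace I x, IsHorizontal g 𝓘(ℝ, EuclideanSpace ℝ (Fin k)) ψ x X →
          IsHorizontal g 𝓘(ℝ, EuclideanSpace ℝ (Fin k)) ψ x Y →
          (euclideanMetric k).inner (ψ x) (mfderiv I 𝓘(ℝ, EuclideanSpace ℝ (Fin k)) ψ x X)
            (mfderiv I 𝓘(ℝ, EuclideanSpace ℝ (Fin k)) ψ x Y) = d ^ 2 * g.inner x X Y) := by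
    intro x
    let A : E →L[ℝ] EuclideanSpace ℝ (Fin k) := mfderiv I 𝓘(ℝ, EuclideanSpace ℝ (Fin k)) ψ x
    let G : E →L[ℝ] E →L[ℝ] ℝ := g.inner x
    have hG : metricInChart g x (extChartAt I x x) = G := metricInChart_self g x
    have hGi : G.IsInvertible := by
      rw [← hG]; exact metricInChart_isInvertible g x (mem_extChartAt_target x)
    have hAd : HasFDerivAt (ψ ∘ (extChartAt I x).symm) A (extChartAt I x x) := by
      have h : HasFDerivWithinAt (ψ ∘ (extChartAt I x).symm) A (Set.range I) (extChartAt I x x) :=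
        ((hψ.1 x).mdifferentiableAt (by simp)).hasMFDerivAt.2
      rwa [I.range_eq_univ, hasFDerivWithinAt_univ] at h
    have hcomp : ∀ (i : Fin k) (c : ℝ), fderiv ℝ ((fun x => ψ x i - c) ∘ (extChartAt I x).symm)
        (extChartAt I x x) = (EuclideanSpace.proj i).comp A := fun i c =>
      (((EuclideanSpace.proj i : EuclideanSpace ℝ (Fin k) →L[ℝ] ℝ).hasFDerivAt.comp _
        hAd).sub_const c).fderiv
    have hgr : ∀ i j c d, gradInner g (fun x => ψ x i - c) (fun x => ψ x j - d) x =
        A (G.inverse ((EuclideanSpace.proj j).comp A)) i := by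
      intro i j c d
      rw [gradInner, hcomp, hcomp, hG]
      rfl
    refine exists_dilation_of_orthogonal_gradients G (g.pos x) A
      (fun j => G.inverse ((EuclideanSpace.proj j).comp A))
      (fun i v => by rw [hGi.self_apply_inverse]; rfl) fun i j hij => ?_
    -- Centring at `ψ x` makes both shifted components vanish at `x`, as the bilaplacian formulas
    -- require.
    have ha := contMDiff_component hψ.1 (ψ x i) i
    have hb := contMDiff_component hψ.1 (ψ x j) j
    have h1 := (hψ.2 Set.univ _ isOpen_univ ⟨x, trivial⟩
      (isHarmonicOn_reQuartic hij (ψ x i) (ψ x j))).2 x trivial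
    have h2 := (hψ.2 Set.univ _ isOpen_univ ⟨x, trivial⟩
      (isHarmonicOn_imQuartic hij (ψ x i) (ψ x j))).2 x trivial
    have h1' := (bilaplacian_reQuartic_of_eq_zero g ha hb (sub_self _) (sub_self _)).symm.trans h1
    have h2' := (bilaplacian_imQuartic_of_eq_zero g ha hb (sub_self _) (sub_self _)).symm.trans h2
    have h3 := eq_of_quartic_relations ((mul_eq_zero.1 h1').resolve_left (by norm_num))
      ((mul_eq_zero.1 h2').resolve_left (by norm_num))
    rwa [hgr, hgr, hgr] at h3
  choose dil hdil using key
  exact ⟨dil, hdil⟩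

theorem IsGeneralizedHarmonicMorphism.isBiharmonicMap {g : SmoothMetric I M} {k : ℕ}
    {ψ : M → EuclideanSpace ℝ (Fin k)}
    (hψ : IsGeneralizedHarmonicMorphism g (euclideanMetric k) ψ) : IsBiharmonicMap g ψ := by
  refine ⟨hψ.1, fun x => ?_⟩
  ext i
  exact (hψ.2 Set.univ _ isOpen_univ ⟨x, trivial⟩ (isHarmonicOn_coord i)).2 x trivial

theorem contMDiff_directSum {k : ℕ} {ψ : M → EuclideanSpace ℝ (Fin k)}
    {φ : N → EuclideanSpace ℝ (Fin k)} (hψ : ContMDiff I 𝓘(ℝ, EuclideanSpace ℝ (Fin k)) ∞ ψ)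
    (hφ : ContMDiff J 𝓘(ℝ, EuclideanSpace ℝ (Fin k)) ∞ φ) :
    ContMDiff (I.prod J) 𝓘(ℝ, EuclideanSpace ℝ (Fin k)) ∞ (directSum ψ φ) :=
  (hψ.comp contMDiff_fst).add (hφ.comp contMDiff_snd)

variable [I.Boundaryless] [J.Boundaryless] [FiniteDimensional ℝ E] [FiniteDimensional ℝ F]

theorem IsGeneralizedHarmonicMorphism.directSum {g : SmoothMetric I M} {h : SmoothMetric J N}
    {k : ℕ} {ψ : M → EuclideanSpace ℝ (Fin k)} {φ : N → EuclideanSpace ℝ (Fin k)}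
    (hψ : IsGeneralizedHarmonicMorphism g (euclideanMetric k) ψ)
    (hφ : IsHarmonicMorphism h (euclideanMetric k) φ) :
    IsGeneralizedHarmonicMorphism (g.prod h) (euclideanMetric k) (directSum ψ φ) := by
  have hsum := contMDiff_directSum hψ.1 hφ.1
  refine ⟨hsum, fun U f hU _ hf => ?_⟩
  set W := _root_.directSum ψ φ ⁻¹' U with hWdef
  have hW : IsOpen W := hU.preimage hsum.continuous
  have hF : ContMDiffOn (I.prod J) 𝓘(ℝ, ℝ) ∞ (f ∘ _root_.directSum ψ φ) W :=
    hf.1.comp hsum.contMDiffOn fun _ hp => hp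
  have hN : ∀ x y, (x, y) ∈ W →
      laplaceBeltrami h (fun y' => (f ∘ _root_.directSum ψ φ) (x, y')) y = 0 := by
    intro x y hxy
    have hy : y ∈ φ ⁻¹' ((fun z => z + ψ x) ⁻¹' U) := by
      change φ y + ψ x ∈ U
      rw [add_comm]
      exact hxy
    have e := (hφ.2 _ _ (hU.preimage (continuous_add_const (ψ x))) ⟨y, hy⟩
      (isHarmonicOn_comp_add hf (ψ x))).2 y hy
    rw [← e]
    congr 1
    funext y'
    exact congrArg f (add_comm _ _)
  have hM : ∀ x y, (x, y) ∈ W → laplaceBeltrami g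
      (laplaceBeltrami g (fun x' => (f ∘ _root_.directSum ψ φ) (x', y))) x = 0 := by
    intro x y hxy
    have hx : x ∈ ψ ⁻¹' ((fun z => z + φ y) ⁻¹' U) := hxy
    exact (hψ.2 _ _ (hU.preimage (continuous_add_const (φ y))) ⟨x, hx⟩
      (isHarmonicOn_comp_add hf (φ y))).2 x hx
  have hL : ∀ x y, (x, y) ∈ W → laplaceBeltrami (g.prod h) (f ∘ _root_.directSum ψ φ) (x, y) =
      laplaceBeltrami g (fun x' => (f ∘ _root_.directSum ψ φ) (x', y)) x := by
    intro x y hxy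
    rw [laplaceBeltrami_prod g h ((hF.contMDiffAt (hW.mem_nhds hxy)).of_le two_le_infty),
      hN x y hxy, add_zero]
  refine ⟨hF, ?_⟩
  rintro ⟨x, y⟩ hxy
  -- Splitting the outer Laplacian requires `Δ F` to be regular.
  have hLF := contMDiffOn_laplaceBeltrami (g.prod h) hW hF
  rw [laplaceBeltrami_prod g h ((hLF.contMDiffAt (hW.mem_nhds hxy)).of_le two_le_infty)]
  have evM : ∀ᶠ x' in 𝓝 x, (x', y) ∈ W :=
    (hW.preimage (f := fun x' => (x', y)) (by fun_prop)).mem_nhds hxy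
  have evN : ∀ᶠ y' in 𝓝 y, (x, y') ∈ W :=
    (hW.preimage (f := fun y' => (x, y')) (by fun_prop)).mem_nhds hxy
  -- `hL` and `hN` hold only on `W`; locality of the Laplacian lets them be used inside a second
  -- Laplacian.
  have e1 := laplaceBeltrami_congr g (evM.mono fun x' hx' => hL x' y hx')
  have e2 := laplaceBeltrami_congr h (evN.mono fun y' hy' => hL x y' hy')
  have e3 := laplaceBeltrami_congr g (evM.mono fun x' hx' => hN x' y hx')
  rw [e1, e2, laplaceBeltrami_slice_comm g h hW hF hxy, e3, hM x y hxy]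
  rw [zero_add]
  exact chartLaplacian_const (metricInChart g x) 0 (extChartAt I x x)

theorem tensionField_directSum {g : SmoothMetric I M} {h : SmoothMetric J N}
    {k : ℕ} {ψ : M → EuclideanSpace ℝ (Fin k)} {φ : N → EuclideanSpace ℝ (Fin k)}
    (hψ : ContMDiff I 𝓘(ℝ, EuclideanSpace ℝ (Fin k)) ∞ ψ)
    (hφ : ContMDiff J 𝓘(ℝ, EuclideanSpace ℝ (Fin k)) ∞ φ) (x : M) (y : N) :
    tensionField (g.prod h) (directSum ψ φ) (x, y) = tensionField g ψ x + tensionField h φ y := by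
  ext i
  -- The shift is `0` because only the bare components are needed; each slice of the sum is then a
  -- component plus a constant.
  have hi : ContMDiff (I.prod J) 𝓘(ℝ, ℝ) ∞ (fun p => directSum ψ φ p i - 0) :=
    contMDiff_component (contMDiff_directSum hψ hφ) 0 i
  have hi' := contMDiff_component hψ 0 i
  have hj' := contMDiff_component hφ 0 i
  simp only [sub_zero] at hi hi' hj'
  refine (laplaceBeltrami_prod g h ((hi _).of_le two_le_infty)).trans ?_
  have e1 := laplaceBeltrami_add g hi' (contMDiff_const (c := φ y i)) x
  have e2 := laplaceBeltrami_add h (contMDiff_const (c := ψ x i)) hj' y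
  rw [laplaceBeltrami_const, add_zero] at e1
  rw [laplaceBeltrami_const, zero_add] at e2
  exact congrArg₂ (· + ·) e1 e2

theorem IsHarmonicMorphism.tensionField_eq_zero {h : SmoothMetric J N} {k : ℕ}
    {φ : N → EuclideanSpace ℝ (Fin k)} (hφ : IsHarmonicMorphism h (euclideanMetric k) φ) (y : N) :
    tensionField h φ y = 0 := by
  ext i
  exact (hφ.2 Set.univ _ isOpen_univ ⟨y, trivial⟩ (isHarmonicOn_coord i)).2 y trivial

end Morphisms

end

theorem proposition3 {m n k : ℕ}
    {M : Type*} [TopologicalSpace M] [ChartedSpace (EuclideanSpace ℝ (Fin m)) M]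
    [IsManifold 𝓘(ℝ, EuclideanSpace ℝ (Fin m)) ∞ M]
    {N : Type*} [TopologicalSpace N] [ChartedSpace (EuclideanSpace ℝ (Fin n)) N]
    [IsManifold 𝓘(ℝ, EuclideanSpace ℝ (Fin n)) ∞ N] [Nonempty N]
    (g : SmoothMetric 𝓘(ℝ, EuclideanSpace ℝ (Fin m)) M)
    (h : SmoothMetric 𝓘(ℝ, EuclideanSpace ℝ (Fin n)) N)
    (ψ : M → EuclideanSpace ℝ (Fin k)) (φ : N → EuclideanSpace ℝ (Fin k))
    (hψ : IsGeneralizedHarmonicMorphism g (euclideanMetric k) ψ)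
    (hφ : IsHarmonicMorphism h (euclideanMetric k) φ) :
    IsGeneralizedHarmonicMorphism (g.prod h) (euclideanMetric k) (directSum ψ φ) ∧
    IsHorizontallyWeaklyConformal (g.prod h) (euclideanMetric k) (directSum ψ φ) ∧
    IsBiharmonicMap (g.prod h) (directSum ψ φ) ∧
    (¬ IsHarmonicMap g ψ → IsProperBiharmonicMap (g.prod h) (directSum ψ φ)) := by
  have hsum := hψ.directSum hφ
  refine ⟨hsum, hsum.isHorizontallyWeaklyConformal, hsum.isBiharmonicMap,
    fun hne => ⟨hsum.isBiharmonicMap, fun hh => hne ⟨hψ.1, fun x => ?_⟩⟩⟩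
  -- A point of `N` is needed to read the tension field of `ψ` off the sum; over an empty product
  -- harmonicity of the sum would be vacuous.
  obtain ⟨y⟩ := ‹Nonempty N›
  have h1 := tensionField_directSum (g := g) (h := h) hψ.1 hφ.1 x y
  rw [hh.2 (x, y), hφ.tensionField_eq_zero y, add_zero] at h1
  exact h1.symm
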